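/- Let $n\ge 0$, let $b(z,w)=\sum_j z_jw_j$ be the standard complex bilinear form on $\mathbb C^n\cong\mathbb R^{2n}$, and let $\langle\ ,\ \rangle=\operatorname{Im} b$, a real inner product of signature $(n,n)$, so that $\mathbb R^{2n}$ becomes $\mathbb R^{(n,n)}$. Orient $\mathbb R^{2n}$ by the basis $e_1,\dots,e_n,ie_1,\dots,ie_n$, and let $IGr^{\pm}(n,\mathbb R^{(n,n)})$ be the manifold of those real $n$-dimensional subspaces $V\subset\mathbb R^{2n}$ which are isotropic for $\langle\ ,\ \rangle$ and self-dual ($+$), respectively anti-self-dual ($-$), i.e. such that the Hodge star satisfies $*(v_1\wedge\dots\wedge v_n)=\pm\, v_1\wedge\dots\wedge v_n$ for $v_1,\dots,v_n\in V$. Fix one of the two signs. For integers $r,s\ge 0$ let $\mathcal O_{(r,s)}\subset IGr^{\pm}(n,\mathbb R^{(n,n)})$ be the set of those $V$ for which the (possibly degenerate) quadratic form $\operatorname{Re} b|_V$ has signature $(r,s)$. For $k\geq 0$ let $\mathcal H_k$ be the real vector space of those real $2k\times 2k$-matrices which represent Hermitian complex $k\times k$-matrices; the signature of an element of $\mathcal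 H_k$ is that of the real symmetric $2k\times 2k$-matrix (hence twice that of the Hermitian matrix). Theorem 4.3. (0) Each $\mathcal O_{(r,s)}$ is invariant under $SO(n,\mathbb C)$, and each $SO(n,\mathbb C)$-orbit in $\mathcal O_{(r,s)}$ is open in $\mathcal O_{(r,s)}$. If $(r,s)\neq(0,0)$, then $\mathcal O_{(r,s)}$ is either empty or a single orbit of $SO(n,\mathbb C)$. (1) Each $\mathcal O_{(r,s)}$ is an embedded smooth submanifold of $IGr^{\pm}(n,\mathbb R^{(n,n)})$. (2) Let $x\in\mathcal O_{(r,s)}$. Then $n-r-s=2k$ for some integer $k\ge 0$, and there are an open neighbourhood $U$ of $x$ in $IGr^{\pm}(n,\mathbb R^{(n,n)})$ and a diffeomorphism $\phi$ from $U$ onto an open neighbourhood of $(U\cap\mathcal O_{(r,s)})\times\{0\}$ in $(U\cap\mathcal O_{(r,s)})\times\mathcal H_k$ such that $U\subset\bigcup_{r'\ge r,\,s'\ge s}\mathcal O_{(r',s')}$, and such that a point $y\in U$ lies in $\mathcal O_{(r',s')}$ if and only if $r'\geq r$, $s'\geq s$ and the second component of $\phi(y)$ has signature $(r'-r,s'-s)$.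 -/

import Mathlib

open scoped Manifold ContDiff InnerProductSpace Matrix

namespace IsoGrass

noncomputable section

/-- Euclidean space `ℝⁿ`. -/
abbrev Rn (n : ℕ) : Type := EuclideanSpace ℝ (Fin n)

/-- `ℂⁿ`, also regarded as the real vector space `ℝ²ⁿ`. -/
abbrev Cn (n : ℕ) : Type := EuclideanSpace ℂ (Fin n)

/-- The standard complex bilinear form `b(z, w) = ∑ zᵢ wᵢ` on `ℂⁿ`. -/
def bForm (n : ℕ) : LinearMap.BilinForm ℂ (Cn n) :=
  LinearMap.mk₂ ℂ (fun z w => ∑ i, z i * w i)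
    (fun z z' w => by simp [add_mul, Finset.sum_add_distrib])
    (fun c z w => by simp [Finset.mul_sum, mul_assoc])
    (fun z w w' => by simp [mul_add, Finset.sum_add_distrib])
    (fun c z w => by simp [Finset.mul_sum, mul_left_comm])

/-- The real part of `b`, a real symmetric bilinear form on `ℝ²ⁿ`. -/
def reForm (n : ℕ) : LinearMap.BilinForm ℝ (Cn n) :=
  LinearMap.mk₂ ℝ (fun z w => (bForm n z w).re)
    (fun z z' w => by simp) (fun c z w => by simp [bForm, mul_sub, Finset.mul_sum])
    (fun z w w' => by simp) (fun c z w => by simp [bForm, mul_sub, Finset.mul_sum])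

/-- The imaginary part of `b`, the split-signature inner product `⟨ , ⟩` on `ℝ²ⁿ = ℝ^(n,n)`. -/
def imForm (n : ℕ) : LinearMap.BilinForm ℝ (Cn n) :=
  LinearMap.mk₂ ℝ (fun z w => (bForm n z w).im)
    (fun z z' w => by simp) (fun c z w => by simp [bForm, Finset.mul_sum])
    (fun z w w' => by simp) (fun c z w => by simp [bForm, Finset.mul_sum])

lemma imForm_apply {n : ℕ} (z w : Cn n) : imForm n z w = ∑ i, (z i * w i).im := by
  simp [imForm, bForm]

/-- The real linear map `z ↦ i z̄`. -/
def conjFlip (n : ℕ) : Cn n →L[ℝ] Cn n :=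
  LinearMap.toContinuousLinearMap
    { toFun := fun z => WithLp.toLp 2 fun i => Complex.I * (starRingEnd ℂ) (z i)
      map_add' := fun z w => by ext i; simp [mul_add]
      map_smul' := fun c z => by ext i; simp [mul_left_comm] }

lemma conjFlip_apply {n : ℕ} (z : Cn n) (i : Fin n) :
    conjFlip n z i = Complex.I * (starRingEnd ℂ) (z i) := rfl

lemma conjFlip_conjFlip {n : ℕ} (z : Cn n) : conjFlip n (conjFlip n z) = z := by
  ext i
  simp only [conjFlip_apply, map_mul, Complex.conj_I, Complex.conj_conj]
  ring_nf; simp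

lemma imForm_eq {n : ℕ} (z w : Cn n) : imForm n z w = ⟪conjFlip n z, w⟫_ℝ := by
  rw [imForm_apply, PiLp.inner_apply]
  refine Finset.sum_congr rfl fun i _ => ?_
  rw [conjFlip_apply, Complex.inner]
  simp
  ring

lemma conjFlip_inner {n : ℕ} (z w : Cn n) : ⟪conjFlip n z, w⟫_ℝ = ⟪z, conjFlip n w⟫_ℝ := by
  rw [PiLp.inner_apply, PiLp.inner_apply]
  refine Finset.sum_congr rfl fun i _ => ?_
  rw [conjFlip_apply, conjFlip_apply, Complex.inner, Complex.inner]
  simp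

/-- The maximal isotropic subspaces of `ℝ^(n,n)`: the real linear subspaces `V ⊆ ℂⁿ` of real
dimension `n` on which `Im b` vanishes. -/
@[ext] structure MaxIso (n : ℕ) where
  V : Submodule ℝ (Cn n)
  finrank_eq : Module.finrank ℝ V = n
  isotropic : ∀ v ∈ V, ∀ w ∈ V, imForm n v w = 0

variable {n : ℕ}

/-- The orthogonal projection onto a subspace, for the Euclidean inner product on `ℝ²ⁿ`. -/
def MaxIso.proj (L : MaxIso n) : Cn n →L[ℝ] Cn n := L.V.starProjection

/-- The usual topology of a Grassmannian: subspaces are close if their orthogonal projections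
are. -/
instance : TopologicalSpace (MaxIso n) := TopologicalSpace.induced MaxIso.proj inferInstance

/-- The skew-symmetric endomorphisms of `ℝⁿ`, the model space of the isotropic Grassmannian. -/
def Skew (n : ℕ) : Submodule ℝ (Rn n →L[ℝ] Rn n) where
  carrier := {A | ∀ x y, ⟪A x, y⟫_ℝ = -⟪x, A y⟫_ℝ}
  add_mem' {A B} hA hB x y := by
    simp only [Set.mem_ofPred_eq] at hA hB
    simp [inner_add_left, inner_add_right, hA x y, hB x y]; ring
  zero_mem' x y := by simp
  smul_mem' c A hA x y := by
    simp only [Set.mem_ofPred_eq] at hA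
    simp [inner_smul_left, inner_smul_right, hA x y]

/-- The projection onto the skew-symmetric part. -/
def skewPart (n : ℕ) : (Rn n →L[ℝ] Rn n) →L[ℝ] Skew n where
  toFun A := ⟨(2⁻¹ : ℝ) • (A - ContinuousLinearMap.adjoint A), fun x y => by
    simp [inner_smul_left, inner_smul_right, inner_sub_left, inner_sub_right,
      ContinuousLinearMap.adjoint_inner_left, ContinuousLinearMap.adjoint_inner_right]; ring⟩
  map_add' A B := by ext1; simp; module
  map_smul' c A := by ext1; simp; module
  cont := by
    refine Continuous.subtype_mk ?_ _
    exact (continuous_id.sub (ContinuousLinearMap.adjoint (𝕜 := ℝ) (E := Rn n)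
      (F := Rn n)).continuous).const_smul (2⁻¹ : ℝ)

lemma skewPart_coe (A : Skew n) : skewPart n A = A := by
  have h : ContinuousLinearMap.adjoint (A : Rn n →L[ℝ] Rn n) = -A := by
    symm
    rw [ContinuousLinearMap.eq_adjoint_iff]
    intro x y
    simp [A.2 x y]
  ext1
  change (2⁻¹ : ℝ) • ((A : Rn n →L[ℝ] Rn n) - ContinuousLinearMap.adjoint (A : Rn n →L[ℝ] Rn n)) = A
  rw [h]; module

/-- An orthonormal frame `ι : ℝⁿ → ℂⁿ` of a maximal isotropic subspace. -/
def MaxIso.frame (L : MaxIso n) : Rn n →ₗᵢ[ℝ] Cn n :=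
  L.V.subtypeₗᵢ.comp
    (((stdOrthonormalBasis ℝ L.V).reindex (finCongr L.finrank_eq)).repr.symm.toLinearIsometry)

lemma MaxIso.frame_mem (L : MaxIso n) (x : Rn n) : L.frame x ∈ L.V := by
  simp [MaxIso.frame]

lemma MaxIso.exists_frame (L : MaxIso n) {v : Cn n} (hv : v ∈ L.V) : ∃ x, L.frame x = v := by
  refine ⟨((stdOrthonormalBasis ℝ L.V).reindex (finCongr L.finrank_eq)).repr ⟨v, hv⟩, ?_⟩
  simp [MaxIso.frame]

lemma MaxIso.proj_mem (L : MaxIso n) (z : Cn n) : L.proj z ∈ L.V :=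
  Submodule.starProjection_apply_mem _ _

lemma MaxIso.proj_eq_self (L : MaxIso n) {z : Cn n} (h : z ∈ L.V) : L.proj z = z :=
  Submodule.starProjection_eq_self_iff.2 h

lemma MaxIso.proj_injective : Function.Injective (MaxIso.proj (n := n)) := by
  intro K L h
  ext z
  constructor
  · intro hz; have := K.proj_eq_self hz; rw [h] at this; rw [← this]; exact L.proj_mem z
  · intro hz; have := L.proj_eq_self hz; rw [← h] at this; rw [← this]; exact K.proj_mem z

lemma MaxIso.continuous_proj : Continuous (MaxIso.proj (n := n)) := continuous_induced_dom


/-- The transpose of the frame of `L`. -/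
def MaxIso.coframe (L : MaxIso n) : Cn n →L[ℝ] Rn n :=
  ContinuousLinearMap.adjoint L.frame.toContinuousLinearMap

lemma MaxIso.coframe_inner (L : MaxIso n) (z : Cn n) (x : Rn n) :
    ⟪L.coframe z, x⟫_ℝ = ⟪z, L.frame x⟫_ℝ := by
  simp [MaxIso.coframe, ContinuousLinearMap.adjoint_inner_left]

lemma MaxIso.coframe_frame (L : MaxIso n) (x : Rn n) : L.coframe (L.frame x) = x := by
  refine ext_inner_right ℝ fun y => ?_
  rw [L.coframe_inner, LinearIsometry.inner_map_map]

lemma MaxIso.inner_frame_conjFlip (L : MaxIso n) (x y : Rn n) :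
    ⟪L.frame x, conjFlip n (L.frame y)⟫_ℝ = 0 := by
  rw [← conjFlip_inner, ← imForm_eq]
  exact L.isotropic _ (L.frame_mem x) _ (L.frame_mem y)

lemma MaxIso.coframe_conjFlip_frame (L : MaxIso n) (x : Rn n) :
    L.coframe (conjFlip n (L.frame x)) = 0 := by
  refine ext_inner_right ℝ fun y => ?_
  rw [L.coframe_inner, real_inner_comm, L.inner_frame_conjFlip, inner_zero_left]

/-- `ℝ²ⁿ` is the orthogonal sum of `L` and its image under `conjFlip`. -/
lemma MaxIso.decomp (L : MaxIso n) (z : Cn n) :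
    z = L.frame (L.coframe z) + conjFlip n (L.frame (L.coframe (conjFlip n z))) := by
  let T : (Rn n × Rn n) →ₗ[ℝ] Cn n :=
    LinearMap.coprod L.frame.toLinearMap ((conjFlip n).toLinearMap ∘ₗ L.frame.toLinearMap)
  have hT : ∀ p, T p = L.frame p.1 + conjFlip n (L.frame p.2) := fun p => by simp [T]
  have h1 : ∀ p, L.coframe (T p) = p.1 := fun p => by
    rw [hT, map_add, L.coframe_frame, L.coframe_conjFlip_frame, add_zero]
  have h2 : ∀ p, L.coframe (conjFlip n (T p)) = p.2 := fun p => by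
    rw [hT, map_add, conjFlip_conjFlip, map_add, L.coframe_frame, L.coframe_conjFlip_frame, zero_add]
  have inj : Function.Injective T := fun p q h => by
    ext1
    · rw [← h1 p, ← h1 q, h]
    · rw [← h2 p, ← h2 q, h]
  have surj : Function.Surjective T := by
    refine (LinearMap.injective_iff_surjective_of_finrank_eq_finrank ?_).1 inj
    rw [← Module.finrank_mul_finrank ℝ ℂ (Cn n)]
    simp; ring
  obtain ⟨p, rfl⟩ := surj z
  rw [h1, h2, hT]

/-- The parametrization `x ↦ ι x + conjFlip (ι (A x))` of a graph over `L`. -/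
def MaxIso.graphMap (L : MaxIso n) (A : Rn n →L[ℝ] Rn n) : Rn n →L[ℝ] Cn n :=
  L.frame.toContinuousLinearMap + (conjFlip n ∘L L.frame.toContinuousLinearMap) ∘L A

lemma MaxIso.graphMap_apply (L : MaxIso n) (A : Rn n →L[ℝ] Rn n) (x : Rn n) :
    L.graphMap A x = L.frame x + conjFlip n (L.frame (A x)) := rfl

lemma MaxIso.coframe_graphMap (L : MaxIso n) (A : Rn n →L[ℝ] Rn n) (x : Rn n) :
    L.coframe (L.graphMap A x) = x := by
  rw [graphMap_apply, map_add, L.coframe_frame, L.coframe_conjFlip_frame, add_zero]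

lemma MaxIso.coframe_conjFlip_graphMap (L : MaxIso n) (A : Rn n →L[ℝ] Rn n) (x : Rn n) :
    L.coframe (conjFlip n (L.graphMap A x)) = A x := by
  rw [graphMap_apply, map_add, conjFlip_conjFlip, map_add, L.coframe_frame, L.coframe_conjFlip_frame, zero_add]

lemma MaxIso.graphMap_injective (L : MaxIso n) (A : Rn n →L[ℝ] Rn n) :
    Function.Injective (L.graphMap A) := fun x y h => by
  rw [← L.coframe_graphMap A x, h, L.coframe_graphMap]

lemma MaxIso.inner_graphMap (L : MaxIso n) (A : Rn n →L[ℝ] Rn n) (z : Cn n) (x : Rn n) :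
    ⟪z, L.graphMap A x⟫_ℝ = ⟪L.coframe z, x⟫_ℝ + ⟪L.coframe (conjFlip n z), A x⟫_ℝ := by
  rw [graphMap_apply, inner_add_right, L.coframe_inner, L.coframe_inner, conjFlip_inner]

lemma MaxIso.imForm_graphMap (L : MaxIso n) (A : Rn n →L[ℝ] Rn n) (x y : Rn n) :
    imForm n (L.graphMap A x) (L.graphMap A y) = ⟪A x, y⟫_ℝ + ⟪x, A y⟫_ℝ := by
  rw [imForm_eq, inner_graphMap, conjFlip_conjFlip, coframe_conjFlip_graphMap, coframe_graphMap]

/-- The maximal isotropic subspace which is the graph over `L` of a skew map. -/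
def MaxIso.graph (L : MaxIso n) (A : Skew n) : MaxIso n where
  V := LinearMap.range (L.graphMap A).toLinearMap
  finrank_eq := by
    rw [LinearMap.finrank_range_of_inj (L.graphMap_injective A)]; simp
  isotropic := by
    rintro _ ⟨x, rfl⟩ _ ⟨y, rfl⟩
    simp only [ContinuousLinearMap.coe_coe]
    rw [L.imForm_graphMap, A.2 x y, neg_add_cancel]

lemma MaxIso.graphMap_mem (L : MaxIso n) (A : Skew n) (x : Rn n) : L.graphMap A x ∈ (L.graph A).V :=
  ⟨x, rfl⟩

lemma MaxIso.eq_of_le {K L : MaxIso n} (h : K.V ≤ L.V) : K = L := by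
  ext1
  exact Submodule.eq_of_le_of_finrank_eq h (by rw [K.finrank_eq, L.finrank_eq])

/-- The block `ι* P ι` of an operator `P` on `ℝ²ⁿ`. -/
def MaxIso.block (L : MaxIso n) (P : Cn n →L[ℝ] Cn n) : Rn n →L[ℝ] Rn n :=
  L.coframe ∘L P ∘L L.frame.toContinuousLinearMap

/-- The chart around `L`, in terms of orthogonal projections. -/
def MaxIso.chartMap (L : MaxIso n) (P : Cn n →L[ℝ] Cn n) : Skew n :=
  skewPart n ((L.coframe ∘L conjFlip n ∘L P ∘L L.frame.toContinuousLinearMap) ∘L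
    Ring.inverse (L.block P))

/-- The orthogonal projection onto the graph of `A`. -/
def MaxIso.graphProj (L : MaxIso n) (A : Rn n →L[ℝ] Rn n) : Cn n →L[ℝ] Cn n :=
  L.graphMap A ∘L Ring.inverse (1 - A ∘L A) ∘L (L.coframe - A ∘L L.coframe ∘L conjFlip n)

lemma isUnit_of_injective {A : Rn n →L[ℝ] Rn n} (h : Function.Injective A) : IsUnit A := by
  have : IsUnit (A : Rn n →ₗ[ℝ] Rn n) :=
    (Module.End.isUnit_iff _).2 ((LinearMap.injective_iff_surjective.1 h) |> fun hs => ⟨h, hs⟩)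
  rw [ContinuousLinearMap.isUnit_iff_bijective]
  exact ⟨h, LinearMap.injective_iff_surjective (f := (A : Rn n →ₗ[ℝ] Rn n)).1 h⟩

lemma isUnit_one_sub (A : Skew n) : IsUnit (1 - (A : Rn n →L[ℝ] Rn n) ∘L (A : Rn n →L[ℝ] Rn n)) := by
  refine isUnit_of_injective ((injective_iff_map_eq_zero _).2 fun x hx => ?_)
  have h : ⟪x - (A : Rn n →L[ℝ] Rn n) ((A : Rn n →L[ℝ] Rn n) x), x⟫_ℝ = 0 := by
    have : x - (A : Rn n →L[ℝ] Rn n) ((A : Rn n →L[ℝ] Rn n) x) = 0 := hx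
    rw [this, inner_zero_left]
  rw [inner_sub_left, A.2 _ x, real_inner_self_eq_norm_sq, real_inner_self_eq_norm_sq] at h
  have : ‖x‖ ^ 2 = 0 := by nlinarith [sq_nonneg ‖x‖, sq_nonneg ‖(A : Rn n →L[ℝ] Rn n) x‖]
  simpa using this

lemma mul_inverse_apply {B : Rn n →L[ℝ] Rn n} (h : IsUnit B) (x : Rn n) :
    B (Ring.inverse B x) = x := by
  rw [← mul_apply_eq_comp, Ring.mul_inverse_cancel _ h, one_apply_eq_self]

lemma inverse_mul_apply {B : Rn n →L[ℝ] Rn n} (h : IsUnit B) (x : Rn n) :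
    Ring.inverse B (B x) = x := by
  rw [← mul_apply_eq_comp, Ring.inverse_mul_cancel _ h, one_apply_eq_self]

lemma MaxIso.proj_graph (L : MaxIso n) (A : Skew n) : (L.graph A).proj = L.graphProj A := by
  ext1 z
  refine Submodule.eq_starProjection_of_mem_of_inner_eq_zero (L.graphMap_mem A _) ?_
  rintro _ ⟨y, rfl⟩
  set w := L.coframe z - (A : Rn n →L[ℝ] Rn n) (L.coframe (conjFlip n z)) with hw
  set u := Ring.inverse (1 - (A : Rn n →L[ℝ] Rn n) ∘L (A : Rn n →L[ℝ] Rn n)) w with hu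
  change ⟪z - L.graphMap A u, L.graphMap A y⟫_ℝ = 0
  have h1 : u - (A : Rn n →L[ℝ] Rn n) ((A : Rn n →L[ℝ] Rn n) u) = w :=
    mul_inverse_apply (isUnit_one_sub A) w
  have h2 : ∀ v y : Rn n, ⟪v, (A : Rn n →L[ℝ] Rn n) y⟫_ℝ = - ⟪(A : Rn n →L[ℝ] Rn n) v, y⟫_ℝ :=
    fun v y => by rw [A.2 v y, neg_neg]
  rw [inner_sub_left, inner_graphMap, inner_graphMap, coframe_graphMap, coframe_conjFlip_graphMap,
    h2, h2, ← sub_eq_add_neg, ← sub_eq_add_neg, ← inner_sub_left, ← inner_sub_left, h1, ← hw,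
    sub_self]

lemma MaxIso.isUnit_block_graph (L : MaxIso n) (A : Skew n) : IsUnit (L.block (L.graph A).proj) := by
  refine isUnit_of_injective ((injective_iff_map_eq_zero _).2 fun x hx => ?_)
  have h0 : ∀ w ∈ (L.graph A).V, ⟪L.frame x - (L.graph A).proj (L.frame x), w⟫_ℝ = 0 :=
    fun w hw => Submodule.starProjection_inner_eq_zero _ _ hw
  have h1 : L.coframe ((L.graph A).proj (L.frame x)) = 0 := hx
  have h2 : (L.graph A).proj (L.frame x) = 0 := by
    have := h0 _ ((L.graph A).proj_mem (L.frame x))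
    rw [inner_sub_left, real_inner_comm, ← L.coframe_inner, h1, inner_zero_left, zero_sub,
      neg_eq_zero] at this
    exact inner_self_eq_zero.1 this
  have h3 := h0 _ (L.graphMap_mem A x)
  rw [h2, sub_zero, inner_graphMap, coframe_frame, coframe_conjFlip_frame, inner_zero_left,
    add_zero] at h3
  exact inner_self_eq_zero.1 h3

/-- Over the domain of the chart around `L`, a subspace is the graph of its chart image. -/
lemma MaxIso.proj_param (L K : MaxIso n) (h : IsUnit (L.block K.proj)) (x : Rn n) :
    K.proj (L.frame (Ring.inverse (L.block K.proj) x)) = L.graphMap (L.chartMap K.proj) x := by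
  set A : Rn n →L[ℝ] Rn n := (L.coframe ∘L conjFlip n ∘L K.proj ∘L L.frame.toContinuousLinearMap) ∘L
    Ring.inverse (L.block K.proj) with hA
  have h1 : ∀ x, K.proj (L.frame (Ring.inverse (L.block K.proj) x)) = L.graphMap A x := by
    intro x
    rw [L.decomp (K.proj _), graphMap_apply]
    congr 2
    exact mul_inverse_apply h x
  have hsk : A ∈ Skew n := by
    intro x y
    have := K.isotropic _ (K.proj_mem (L.frame (Ring.inverse (L.block K.proj) x)))
      _ (K.proj_mem (L.frame (Ring.inverse (L.block K.proj) y)))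
    rw [h1, h1, imForm_graphMap] at this
    linarith
  have h2 : L.chartMap K.proj = ⟨A, hsk⟩ := skewPart_coe ⟨A, hsk⟩
  rw [h1, h2]

lemma MaxIso.graph_chartMap (L K : MaxIso n) (h : IsUnit (L.block K.proj)) :
    L.graph (L.chartMap K.proj) = K := by
  refine eq_of_le ?_
  rintro _ ⟨x, rfl⟩
  exact (L.proj_param K h x) ▸ K.proj_mem _

lemma MaxIso.chartMap_graph (L : MaxIso n) (A : Skew n) : L.chartMap (L.graph A).proj = A := by
  have h := L.isUnit_block_graph A
  ext1; ext1 x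
  have h1 : L.graphMap (L.chartMap (L.graph A).proj) x ∈ (L.graph A).V :=
    (L.proj_param _ h x) ▸ (L.graph A).proj_mem _
  obtain ⟨y, hy⟩ := h1
  replace hy : L.graphMap A y = L.graphMap (L.chartMap (L.graph A).proj) x := hy
  have hxy : y = x := by
    rw [← L.coframe_graphMap A y, hy, coframe_graphMap]
  rw [← L.coframe_conjFlip_graphMap _ x, ← hy, coframe_conjFlip_graphMap, hxy]

lemma MaxIso.contDiff_block (L : MaxIso n) : ContDiff ℝ ∞ L.block := by
  unfold MaxIso.block
  fun_prop

lemma contDiff_skewPart : ContDiff ℝ ∞ (fun A => skewPart n A) :=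
  ContinuousLinearMap.contDiff (𝕜 := ℝ) (E := Rn n →L[ℝ] Rn n) (F := Skew n) (skewPart n)

lemma MaxIso.contDiffAt_chartMap (L : MaxIso n) {P : Cn n →L[ℝ] Cn n} (h : IsUnit (L.block P)) :
    ContDiffAt ℝ ∞ L.chartMap P := by
  unfold MaxIso.chartMap
  refine contDiff_skewPart.contDiffAt.comp P ?_
  refine ContDiffAt.clm_comp (by fun_prop) ?_
  obtain ⟨u, hu⟩ := h
  exact ContDiffAt.comp P (hu ▸ contDiffAt_ringInverse ℝ u) L.contDiff_block.contDiffAt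

lemma MaxIso.contDiff_graphProj (L : MaxIso n) :
    ContDiff ℝ ∞ fun A : Skew n => L.graphProj (A : Rn n →L[ℝ] Rn n) := by
  have hc : ContDiff ℝ ∞ fun A : Skew n => (A : Rn n →L[ℝ] Rn n) :=
    ContinuousLinearMap.contDiff (𝕜 := ℝ) (E := Skew n) (F := Rn n →L[ℝ] Rn n) (Skew n).subtypeL
  rw [contDiff_iff_contDiffAt]
  intro A
  unfold MaxIso.graphProj MaxIso.graphMap
  refine ContDiffAt.clm_comp (by fun_prop) (ContDiffAt.clm_comp ?_ (by fun_prop))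
  obtain ⟨u, hu⟩ := isUnit_one_sub A
  refine ContDiffAt.comp (g := Ring.inverse)
    (f := fun A : Skew n => 1 - (A : Rn n →L[ℝ] Rn n) ∘L (A : Rn n →L[ℝ] Rn n)) A
    (hu ▸ contDiffAt_ringInverse ℝ u) (by fun_prop)

/-- The chart around `L`: a maximal isotropic subspace that is transverse to the orthogonal
complement of `L` is the graph of a skew map. -/
def MaxIso.chart (L : MaxIso n) : OpenPartialHomeomorph (MaxIso n) (Skew n) where
  toFun K := L.chartMap K.proj
  invFun := L.graph
  source := {K | IsUnit (L.block K.proj)}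
  target := Set.univ
  map_source' _ _ := trivial
  map_target' A _ := L.isUnit_block_graph A
  left_inv' K h := L.graph_chartMap K h
  right_inv' A _ := L.chartMap_graph A
  open_source := Units.isOpen.preimage (L.contDiff_block.continuous.comp continuous_proj)
  open_target := isOpen_univ
  continuousOn_toFun K h :=
    ((L.contDiffAt_chartMap h).continuousAt.comp continuous_proj.continuousAt).continuousWithinAt
  continuousOn_invFun := by
    refine Continuous.continuousOn (continuous_induced_rng.2 ?_)
    refine L.contDiff_graphProj.continuous.congr fun A => (L.proj_graph A).symm

lemma MaxIso.mem_chart_source (L : MaxIso n) : L ∈ L.chart.source := by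
  change IsUnit (L.block L.proj)
  have : L.block L.proj = 1 := by
    ext1 x
    change L.coframe (L.proj (L.frame x)) = x
    rw [L.proj_eq_self (L.frame_mem x), L.coframe_frame]
  rw [this]; exact isUnit_one

/-- The smooth structure of the isotropic Grassmannian, given by the graph charts. -/
instance : ChartedSpace (Skew n) (MaxIso n) where
  atlas := Set.range MaxIso.chart
  chartAt := MaxIso.chart
  mem_chart_source := MaxIso.mem_chart_source
  chart_mem_atlas L := ⟨L, rfl⟩

instance : IsManifold 𝓘(ℝ, Skew n) ∞ (MaxIso n) := by
  refine isManifold_of_contDiffOn _ _ _ ?_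
  rintro _ _ ⟨L, rfl⟩ ⟨L', rfl⟩
  rintro A ⟨⟨-, hA⟩, -⟩
  have hA' : IsUnit (L'.block (L.graphProj A)) := L.proj_graph A ▸ hA
  refine ContDiffAt.contDiffWithinAt ?_
  refine ((L'.contDiffAt_chartMap hA').comp A L.contDiff_graphProj.contDiffAt).congr_of_eventuallyEq
    (Filter.Eventually.of_forall fun B => ?_)
  change L'.chartMap (L.graph B).proj = L'.chartMap (L.graphProj B)
  rw [L.proj_graph]

/-- The matrix of real coordinates of `2n` vectors in `ℝ²ⁿ`, with respect to the real basis
`e₁, …, eₙ, i e₁, …, i eₙ`. -/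
def coordMatrix (w : Fin n ⊕ Fin n → Cn n) : Matrix (Fin n ⊕ Fin n) (Fin n ⊕ Fin n) ℝ :=
  Matrix.of fun a => Sum.elim (fun i => (w a i).re) (fun i => (w a i).im)

/-- The volume form on `ℝ²ⁿ` normalised to be `1` on `e₁, …, eₙ, i e₁, …, i eₙ`. -/
def vol (w : Fin n ⊕ Fin n → Cn n) : ℝ := (coordMatrix w).det

/-- The matrix of mutual inner products `⟨uᵢ, vⱼ⟩`. -/
def gram (u v : Fin n → Cn n) : Matrix (Fin n) (Fin n) ℝ := Matrix.of fun i j => imForm n (u i) (v j)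

/-- `V` is self-dual (`ε = 1`) or anti-self-dual (`ε = -1`): for `β = v₁ ∧ ⋯ ∧ vₙ` with `vᵢ ∈ V`
one has `*β = ε β`, where `*` is characterised by `α ∧ *β = ⟨α, β⟩ vol`. Here this identity is
tested on all decomposable `α = u₁ ∧ ⋯ ∧ uₙ`, for which `⟨α, β⟩ = det ⟨uᵢ, vⱼ⟩`. -/
def HodgeEigen (ε : ℤˣ) (V : Submodule ℝ (Cn n)) : Prop :=
  ∀ u v : Fin n → Cn n, (∀ i, v i ∈ V) → ((ε : ℤ) : ℝ) * vol (Sum.elim u v) = (gram u v).det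

lemma coordMatrix_mul_transpose (w : Fin n ⊕ Fin n → Cn n) :
    coordMatrix w * (coordMatrix w)ᵀ = Matrix.of fun a c => ⟪w a, w c⟫_ℝ := by
  ext a c
  rw [Matrix.mul_apply, Matrix.of_apply, PiLp.inner_apply, Fintype.sum_sum_type,
    ← Finset.sum_add_distrib]
  refine Finset.sum_congr rfl fun i _ => ?_
  rw [Complex.inner]
  simp [coordMatrix]
  ring

/-- The coordinate vector in `ℝⁿ`. -/
abbrev stdVec (i : Fin n) : Rn n := EuclideanSpace.single i 1

lemma inner_stdVec (x : Rn n) (i : Fin n) : ⟪x, stdVec i⟫_ℝ = x i := by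
  simp [stdVec, EuclideanSpace.inner_single_right]

lemma sum_stdVec (x : Rn n) : x = ∑ i, x i • stdVec i := by
  ext j
  simp [stdVec, Finset.sum_apply, Pi.single_apply]

/-- The orthonormal basis of `ℝ²ⁿ` adapted to `L`. -/
def MaxIso.adapted (L : MaxIso n) : Fin n ⊕ Fin n → Cn n :=
  Sum.elim (fun i => conjFlip n (L.frame (stdVec i))) (fun i => L.frame (stdVec i))

lemma MaxIso.vol_adapted_sq (L : MaxIso n) : vol L.adapted * vol L.adapted = 1 := by
  have h : coordMatrix L.adapted * (coordMatrix L.adapted)ᵀ = 1 := by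
    rw [coordMatrix_mul_transpose]
    ext a c
    rcases a with a | a <;> rcases c with c | c <;>
      simp only [Matrix.of_apply, MaxIso.adapted, Sum.elim_inl, Sum.elim_inr]
    · rw [conjFlip_inner, conjFlip_conjFlip, LinearIsometry.inner_map_map, inner_stdVec]
      simp [Matrix.one_apply, eq_comm]
    · rw [real_inner_comm, L.inner_frame_conjFlip]; simp
    · rw [L.inner_frame_conjFlip]; simp
    · rw [LinearIsometry.inner_map_map, inner_stdVec]
      simp [Matrix.one_apply, eq_comm]
  have := congrArg Matrix.det h
  rwa [Matrix.det_mul, Matrix.det_transpose, Matrix.det_one] at this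

lemma MaxIso.vol_eq (L : MaxIso n) (u v : Fin n → Cn n) (hv : ∀ i, v i ∈ L.V) :
    vol (Sum.elim u v) = (gram u v).det * vol L.adapted := by
  choose y hy using fun i => L.exists_frame (hv i)
  let X : Matrix (Fin n) (Fin n) ℝ := Matrix.of fun i j => L.coframe (u i) j
  let X' : Matrix (Fin n) (Fin n) ℝ := Matrix.of fun i j => L.coframe (conjFlip n (u i)) j
  let Y : Matrix (Fin n) (Fin n) ℝ := Matrix.of fun i j => y i j
  have hfr : ∀ x : Rn n, L.frame x = ∑ j, x j • L.frame (stdVec j) := fun x => by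
    conv_lhs => rw [sum_stdVec x]
    simp
  have h1 : coordMatrix (Sum.elim u v) = Matrix.fromBlocks X' X 0 Y * coordMatrix L.adapted := by
    have key : ∀ a, (Sum.elim u v : Fin n ⊕ Fin n → Cn n) a =
        ∑ c, (Matrix.fromBlocks X' X 0 Y) a c • L.adapted c := by
      rintro (i | i)
      · simp only [Sum.elim_inl, Fintype.sum_sum_type, Matrix.fromBlocks_apply₁₁,
          Matrix.fromBlocks_apply₁₂, MaxIso.adapted, Sum.elim_inr, X, X', Matrix.of_apply]
        rw [← hfr]
        conv_lhs => rw [L.decomp (u i), hfr (L.coframe (conjFlip n (u i)))]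
        rw [add_comm, map_sum]
        simp
      · simp only [Sum.elim_inl, Fintype.sum_sum_type, Matrix.fromBlocks_apply₂₁,
          Matrix.fromBlocks_apply₂₂, MaxIso.adapted, Sum.elim_inr, Y, Matrix.of_apply]
        rw [← hfr, hy]
        simp
    ext a c
    rw [Matrix.mul_apply]
    rcases c with c | c <;>
    · simp only [coordMatrix, Matrix.of_apply, Sum.elim_inl, Sum.elim_inr]
      rw [key a]
      simp
  have h2 : gram u v = X' * Yᵀ := by
    ext i j
    simp only [gram, Matrix.of_apply, Matrix.mul_apply, Matrix.transpose_apply, X', Y]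
    rw [imForm_eq, ← hy, ← L.coframe_inner, PiLp.inner_apply]
    exact Finset.sum_congr rfl fun k _ => by simp [mul_comm]
  rw [vol, h1, Matrix.det_mul, Matrix.det_fromBlocks_zero₂₁, h2, Matrix.det_mul,
    Matrix.det_transpose, vol]

lemma MaxIso.hodgeEigen_iff (L : MaxIso n) (ε : ℤˣ) :
    HodgeEigen ε L.V ↔ ((ε : ℤ) : ℝ) * vol L.adapted = 1 := by
  constructor
  · intro h
    have h1 := h (fun i => conjFlip n (L.frame (stdVec i))) (fun i => L.frame (stdVec i))
      fun i => L.frame_mem _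
    refine h1.trans ?_
    have : gram (fun i => conjFlip n (L.frame (stdVec i))) (fun i => L.frame (stdVec i)) = 1 := by
      ext i j
      rw [gram, Matrix.of_apply, imForm_eq, conjFlip_conjFlip, LinearIsometry.inner_map_map, inner_stdVec]
      simp [Matrix.one_apply, eq_comm]
    rw [this, Matrix.det_one]
  · intro h u v hv
    rw [L.vol_eq u v hv, mul_left_comm, h, mul_one]

/-- A maximal isotropic subspace is either self-dual or anti-self-dual, but not both. -/
lemma MaxIso.hodgeEigen_neg_iff (L : MaxIso n) (ε : ℤˣ) :
    HodgeEigen (-ε) L.V ↔ ¬ HodgeEigen ε L.V := by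
  rw [L.hodgeEigen_iff, L.hodgeEigen_iff]
  rcases mul_self_eq_one_iff.1 L.vol_adapted_sq with h | h <;>
    rcases Int.units_eq_one_or ε with rfl | rfl <;> rw [h] <;> norm_num

lemma isClosed_hodgeEigen (ε : ℤˣ) : IsClosed {L : MaxIso n | HodgeEigen ε L.V} := by
  have h : {L : MaxIso n | HodgeEigen ε L.V} = {L | ∀ u w : Fin n → Cn n,
      ((ε : ℤ) : ℝ) * vol (Sum.elim u fun i => L.proj (w i)) =
        (gram u fun i => L.proj (w i)).det} := by
    ext L
    constructor
    · exact fun h u w => h u _ fun i => L.proj_mem _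
    · intro h u v hv
      have := h u v
      simpa only [fun i => L.proj_eq_self (hv i)] using this
  rw [h]
  simp only [Set.ofPred_forall]
  refine isClosed_iInter fun u => isClosed_iInter fun w => ?_
  have hp : ∀ i, Continuous fun L : MaxIso n => L.proj (w i) := fun i =>
    MaxIso.continuous_proj.clm_apply continuous_const
  refine isClosed_eq (continuous_const.mul (Continuous.matrix_det ?_)) (Continuous.matrix_det ?_)
  · refine continuous_matrix fun a c => ?_
    rcases a with a | a <;> rcases c with c | c <;>
      simp only [coordMatrix, Matrix.of_apply, Sum.elim_inl, Sum.elim_inr] <;> fun_prop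
  · refine continuous_matrix fun i j => ?_
    simp only [gram, Matrix.of_apply, imForm_eq]
    fun_prop

/-- `IGr^±(n, ℝ^(n,n))`: the self-dual (`ε = 1`), respectively anti-self-dual (`ε = -1`), maximal
isotropic subspaces. It is an open subset of the space of all maximal isotropic subspaces, from
which it inherits its smooth structure. -/
def IGr (n : ℕ) (ε : ℤˣ) : TopologicalSpace.Opens (MaxIso n) where
  carrier := {L | HodgeEigen ε L.V}
  is_open' := by
    have : {L : MaxIso n | HodgeEigen ε L.V} = {L | HodgeEigen (-ε) L.V}ᶜ := by
      ext L
      have := L.hodgeEigen_neg_iff (-ε)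
      rwa [neg_neg] at this
    rw [this]
    exact (isClosed_hodgeEigen (-ε)).isOpen_compl

/-- The complex special orthogonal group `SO(n, ℂ) = {g | g gᵀ = 1, det g = 1}`. -/
abbrev SO (n : ℕ) := Matrix.specialOrthogonalGroup (Fin n) ℂ

lemma SO.transpose_mul (g : SO n) :
    (g : Matrix (Fin n) (Fin n) ℂ)ᵀ * (g : Matrix (Fin n) (Fin n) ℂ) = 1 :=
  (Matrix.mem_orthogonalGroup_iff' (Fin n) ℂ).1 g.2.1

/-- The action of a complex matrix on `ℂⁿ`, as a real linear map. -/
def actMap (g : Matrix (Fin n) (Fin n) ℂ) : Cn n →ₗ[ℝ] Cn n :=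
  (Matrix.toEuclideanLin g).restrictScalars ℝ

lemma actMap_apply (g : Matrix (Fin n) (Fin n) ℂ) (z : Cn n) (i : Fin n) :
    actMap g z i = ∑ j, g i j * z j := rfl

lemma actMap_one : actMap (1 : Matrix (Fin n) (Fin n) ℂ) = LinearMap.id := by
  ext1 z; ext i; simp [actMap_apply, Matrix.one_apply]

lemma actMap_mul (g h : Matrix (Fin n) (Fin n) ℂ) : actMap (g * h) = actMap g ∘ₗ actMap h := by
  ext1 z; ext i
  simp only [actMap_apply, LinearMap.comp_apply, Matrix.mul_apply, Finset.sum_mul, Finset.mul_sum]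
  rw [Finset.sum_comm]
  simp only [mul_assoc]

lemma bForm_actMap (g : SO n) (z w : Cn n) :
    bForm n (actMap g z) (actMap g w) = bForm n z w := by
  have h : ∀ z w : Cn n, bForm n z w = (fun i => z i) ⬝ᵥ (fun i => w i) := fun _ _ => rfl
  have h' : ∀ z : Cn n, (fun i => actMap g z i) =
      (g : Matrix (Fin n) (Fin n) ℂ) *ᵥ (fun i => z i) := fun _ => rfl
  rw [h, h, h', h', Matrix.dotProduct_mulVec, ← Matrix.mulVec_transpose, Matrix.mulVec_mulVec,
    SO.transpose_mul, Matrix.one_mulVec]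

/-- `SO(n, ℂ)` acts on the maximal isotropic subspaces by `g • V = g(V)`. -/
instance : MulAction (SO n) (MaxIso n) where
  smul g L :=
    { V := L.V.map (actMap g)
      finrank_eq := by
        have h : Function.LeftInverse (actMap (g : Matrix (Fin n) (Fin n) ℂ)ᵀ) (actMap g) :=
          fun z => by
            rw [← LinearMap.comp_apply, ← actMap_mul, SO.transpose_mul, actMap_one]; rfl
        exact ((Submodule.equivMapOfInjective _ h.injective L.V).finrank_eq).symm.trans L.finrank_eq
      isotropic := by
        rintro _ ⟨v, hv, rfl⟩ _ ⟨w, hw, rfl⟩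
        have := L.isotropic v hv w hw
        simpa [imForm, bForm_actMap] using this }
  one_smul L := by
    ext1
    change L.V.map (actMap 1) = L.V
    rw [actMap_one, Submodule.map_id]
  mul_smul g h L := by
    ext1
    change L.V.map (actMap ((g : Matrix (Fin n) (Fin n) ℂ) * (h : Matrix (Fin n) (Fin n) ℂ))) =
      (L.V.map (actMap h)).map (actMap g)
    rw [actMap_mul, Submodule.map_comp]

/-- The real quadratic form `Q` has signature `(p, q)`: `p` and `q` are the maximal dimensions of
subspaces on which `Q` is positive, respectively negative, definite. `Q` may be degenerate. -/
def HasSignature {M : Type*} [AddCommGroup M] [Module ℝ M] (Q : QuadraticForm ℝ M) (p q : ℕ) :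
    Prop :=
  sigPos Q = p ∧ sigNeg Q = q

/-- The restriction of `Re b` to `V`, as a quadratic form. -/
def reQuad (V : Submodule ℝ (Cn n)) : QuadraticForm ℝ V :=
  (LinearMap.BilinMap.toQuadraticMap (reForm n)).restrict V

/-- `𝒪₍ᵣ,ₛ₎` inside `IGr⁺` (`ε = 1`) or `IGr⁻` (`ε = -1`): the set of those maximal isotropic
subspaces on which the restriction of `Re b` has signature `(r, s)`. -/
def orbitSet (n : ℕ) (ε : ℤˣ) (r s : ℕ) : Set (IGr n ε) :=
  {L | HasSignature (reQuad (L : MaxIso n).V) r s}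

/-- The real `2k × 2k` matrix representing a complex `k × k` matrix, as a map from `ℂ`-matrices to
arrays of real numbers. -/
def realify {k : ℕ} :
    Matrix (Fin k) (Fin k) ℂ →ₗ[ℝ] (Fin k ⊕ Fin k → Fin k ⊕ Fin k → ℝ) where
  toFun h := Matrix.of.symm (Matrix.fromBlocks (h.map Complex.re) (-h.map Complex.im)
    (h.map Complex.im) (h.map Complex.re))
  map_add' g h := by
    ext a c; rcases a with a | a <;> rcases c with c | c <;> simp [add_comm]
  map_smul' t h := by
    ext a c; rcases a with a | a <;> rcases c with c | c <;> simp

/-- `ℋₖ`: the real `2k × 2k` matrices which represent Hermitian complex `k × k` matrices. They are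
written as arrays of real numbers, so that `ℋₖ` is a normed space. -/
def HermMat (k : ℕ) : Submodule ℝ (Fin k ⊕ Fin k → Fin k ⊕ Fin k → ℝ) :=
  (selfAdjoint.submodule ℝ (Matrix (Fin k) (Fin k) ℂ)).map realify

lemma mem_HermMat {k : ℕ} (M : Fin k ⊕ Fin k → Fin k ⊕ Fin k → ℝ) :
    M ∈ HermMat k ↔ ∃ h : Matrix (Fin k) (Fin k) ℂ, h.IsHermitian ∧
      Matrix.of M = Matrix.fromBlocks (h.map Complex.re) (-h.map Complex.im)
        (h.map Complex.im) (h.map Complex.re) :=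
  ⟨fun ⟨h, hh, e⟩ => ⟨h, hh, e ▸ rfl⟩, fun ⟨h, hh, e⟩ => ⟨h, hh, e.symm⟩⟩

/-- The signature of a matrix in `ℋₖ`, as a real symmetric matrix. -/
def HermMat.HasSignature {k : ℕ} (M : HermMat k) (p q : ℕ) : Prop :=
  IsoGrass.HasSignature
    (Matrix.of (M : Fin k ⊕ Fin k → Fin k ⊕ Fin k → ℝ)).toQuadraticForm' p q

end

end IsoGrass

open IsoGrass

/-!
Around a maximal isotropic subspace `L`, the graph chart identifies the nearby subspaces with the
skew endomorphisms `A` of `ℝⁿ`. An adapted frame (`Frame`) of `L` consists of vectors `wᵢ` on which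
`b` is diagonal with `r` entries `1` and `s` entries `-1`, and of a unitary basis `eⱼ`, `j ≤ k`, of
the radical of `b|_L`. Since `Im b` vanishes on `L` and `L` is maximal, this radical is the largest
complex subspace of `L`; hence its real dimension is `2k` and `n = r + s + 2k`. Such a frame exists
exactly if `Re b|_L` has signature `(r, s)` (`Frame.hasSignature`, `exists_frame_of_hasSignature`).

For a graph over `L`, take the Gram matrix of `Re b` in the lifted basis `wᵢ, eⱼ, i eⱼ`. Near `L` its
`w`-block has signature `(r, s)`, so the signature of the graph is `(r, s)` plus that of the Schur
complement `H(A)` of this block (`Frame.hasSignature_graph`). Two facts make `H` a perfect defining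
function of `𝒪₍ᵣ,ₛ₎`:

* `H(A)` lies in `ℋₖ` (`Frame.schur_mem_HermMat`).
* The vector space `ℋₖ` acts on the chart by translations, which move the points of a graph by
  vectors in the conjugate of the radical of `L`, and `H(A + M) = H(A) + M`
  (`Frame.schur_add_trans`).

Thus no implicit function theorem is needed: subtracting `H(A)` is a smooth retraction onto
`𝒪₍ᵣ,ₛ₎ = {H = 0}`, linear coordinates transverse to the translations are charts of `𝒪₍ᵣ,ₛ₎`, and the
retraction together with `H` is the slice diffeomorphism. This formal part is carried out for
arbitrary manifolds in `SliceChart`; `exists_sliceChart` provides the charts.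

For the orbits, two adapted frames extended by the conjugates `ēⱼ` are complex bases of `ℂⁿ` with the
same Gram matrix for `b`, so that a complex orthogonal matrix maps one to the other; if `r + s > 0`,
its determinant can be corrected by a sign at one `wᵢ` (`Frame.mem_orbit`). If `(r, s) = (0, 0)`, a
graph over `L` on which `b` vanishes is the image of `L` under a unipotent orthogonal matrix
(`Frame.graph_mem_orbit`), which has determinant `1`, so orbits are open.
-/

open scoped Topology

namespace IsoGrass

noncomputable section

/-! ### Subsets with equivariant defining functions are embedded submanifolds -/

section Slice

variable {E F X : Type*} [NormedAddCommGroup E] [NormedSpace ℝ E] [NormedAddCommGroup F]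
  [NormedSpace ℝ F] [TopologicalSpace X] [ChartedSpace E X]

/-- A chart of `X` in which the subset `O` is the zero set of a smooth `F`-valued function `H` that
is equivariant for a linear action `τ` of `F` on the model space by translations. The splitting
provides linear coordinates, with values in `ℝᵐ`, transverse to these translations. The chart is
not required to be centred anywhere, and the zero set may be empty. -/
structure SliceChart (X F : Type*) [NormedAddCommGroup F] [NormedSpace ℝ F] [TopologicalSpace X]
    [ChartedSpace E X] (O : Set X) (m : ℕ) where
  chart : OpenPartialHomeomorph X E
  chart_mem : chart ∈ IsManifold.maximalAtlas 𝓘(ℝ, E) ∞ X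
  τ : F →L[ℝ] E
  H : E → F
  contDiffOn_H : ContDiffOn ℝ ∞ H chart.target
  add_mem : ∀ A ∈ chart.target, ∀ f, A + τ f ∈ chart.target
  H_add : ∀ A ∈ chart.target, ∀ f, H (A + τ f) = H A + f
  mem_iff : ∀ y ∈ chart.source, y ∈ O ↔ H (chart y) = 0
  split : E ≃L[ℝ] (EuclideanSpace ℝ (Fin m) × F)
  split_τ : ∀ f, split (τ f) = (0, f)

namespace SliceChart

variable {O : Set X} {m : ℕ} (c : SliceChart (E := E) X F O m)

/-- The retraction of the chart domain onto the zero set of `H` along the translations. -/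
def retr (A : E) : E := A - c.τ (c.H A)

/-- The parametrization of the zero set of `H` by the transverse coordinates. -/
def sect (t : EuclideanSpace ℝ (Fin m)) : E := c.retr (c.split.symm (t, 0))

lemma sub_mem {A : E} (hA : A ∈ c.chart.target) (f : F) : A - c.τ f ∈ c.chart.target := by
  simpa [sub_eq_add_neg] using c.add_mem A hA (-f)

lemma H_sub {A : E} (hA : A ∈ c.chart.target) (f : F) : c.H (A - c.τ f) = c.H A - f := by
  simpa [sub_eq_add_neg] using c.H_add A hA (-f)

lemma retr_mem {A : E} (hA : A ∈ c.chart.target) : c.retr A ∈ c.chart.target :=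
  c.sub_mem hA _

lemma H_retr {A : E} (hA : A ∈ c.chart.target) : c.H (c.retr A) = 0 := by
  rw [retr, c.H_sub hA, sub_self]

lemma symm_split (A : E) : c.split.symm ((c.split A).1, 0) = A - c.τ (c.split A).2 := by
  rw [ContinuousLinearEquiv.symm_apply_eq, map_sub, c.split_τ]
  ext1 <;> simp

lemma symm_split_mem {A : E} (hA : A ∈ c.chart.target) :
    c.split.symm ((c.split A).1, 0) ∈ c.chart.target := by
  rw [symm_split]; exact c.sub_mem hA _

lemma sect_split {A : E} (hA : A ∈ c.chart.target) : c.sect (c.split A).1 = c.retr A := by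
  rw [sect, symm_split, retr, c.H_sub hA, map_sub, retr]; abel

lemma split_retr (A : E) : (c.split (c.retr A)).1 = (c.split A).1 := by
  simp [retr, c.split_τ]

lemma split_sect (t : EuclideanSpace ℝ (Fin m)) : (c.split (c.sect t)).1 = t := by
  rw [sect, split_retr]; simp

lemma contDiffOn_retr : ContDiffOn ℝ ∞ c.retr c.chart.target :=
  contDiffOn_id.sub (c.τ.contDiff.comp_contDiffOn c.contDiffOn_H)

lemma isOpen_transverse :
    IsOpen {t : EuclideanSpace ℝ (Fin m) | c.split.symm (t, 0) ∈ c.chart.target} :=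
  c.chart.open_target.preimage (by fun_prop)

lemma contDiffOn_sect : ContDiffOn ℝ ∞ c.sect
    {t : EuclideanSpace ℝ (Fin m) | c.split.symm (t, 0) ∈ c.chart.target} :=
  c.contDiffOn_retr.comp (t := c.chart.target) (f := fun t => c.split.symm (t, 0))
    (c.split.symm.contDiff.comp (contDiff_id.prodMk contDiff_const)).contDiffOn fun _ h => h

lemma sect_mem {t : EuclideanSpace ℝ (Fin m)} (h : c.split.symm (t, 0) ∈ c.chart.target) :
    c.sect t ∈ c.chart.target := c.retr_mem h

lemma symm_retr_mem {A : E} (hA : A ∈ c.chart.target) : c.chart.symm (c.retr A) ∈ O := by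
  rw [c.mem_iff _ (c.chart.map_target (c.retr_mem hA)), c.chart.right_inv (c.retr_mem hA),
    c.H_retr hA]

lemma symm_sect_mem {t : EuclideanSpace ℝ (Fin m)} (h : c.split.symm (t, 0) ∈ c.chart.target) :
    c.chart.symm (c.sect t) ∈ O := c.symm_retr_mem h

lemma retr_eq_self {y : X} (hy : y ∈ c.chart.source) (hO : y ∈ O) :
    c.retr (c.chart y) = c.chart y := by
  rw [retr, (c.mem_iff y hy).1 hO]; simp

open Classical in
/-- The chart of `O` obtained from a slice chart: the transverse coordinates. The point `x₀` only
serves as a value of the inverse outside of the chart image. -/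
def subChart (x₀ : O) : OpenPartialHomeomorph O (EuclideanSpace ℝ (Fin m)) where
  toFun y := (c.split (c.chart y)).1
  invFun t := if h : c.chart.symm (c.sect t) ∈ O then ⟨_, h⟩ else x₀
  source := {y | (y : X) ∈ c.chart.source}
  target := {t | c.split.symm (t, 0) ∈ c.chart.target}
  map_source' y hy := c.symm_split_mem (c.chart.map_source hy)
  map_target' t ht := by
    have h := c.symm_sect_mem ht
    simp only [Set.mem_ofPred_eq]
    rw [dif_pos h]
    exact c.chart.map_target (c.sect_mem ht)
  left_inv' y hy := by
    have h : c.chart.symm (c.sect (c.split (c.chart y)).1) = y := by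
      rw [c.sect_split (c.chart.map_source hy), c.retr_eq_self hy y.2, c.chart.left_inv hy]
    rw [dif_pos (h.symm ▸ y.2)]
    exact Subtype.ext h
  right_inv' t ht := by
    have h := c.symm_sect_mem ht
    rw [dif_pos h]
    change (c.split (c.chart (c.chart.symm (c.sect t)))).1 = t
    rw [c.chart.right_inv (c.sect_mem ht), c.split_sect]
  open_source := c.chart.open_source.preimage continuous_subtype_val
  open_target := c.isOpen_transverse
  continuousOn_toFun := by
    refine (continuous_fst.comp c.split.continuous).comp_continuousOn ?_
    exact c.chart.continuousOn.comp continuous_subtype_val.continuousOn fun _ h => h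
  continuousOn_invFun := by
    rw [Topology.IsInducing.subtypeVal.continuousOn_iff]
    refine ContinuousOn.congr (f := fun t => c.chart.symm (c.sect t)) ?_ ?_
    · exact c.chart.symm.continuousOn.comp c.contDiffOn_sect.continuousOn fun t ht => c.sect_mem ht
    · intro t ht
      have h := c.symm_sect_mem ht
      simp only [Function.comp_apply]
      rw [dif_pos h]

lemma subChart_symm_apply (x₀ : O) {t : EuclideanSpace ℝ (Fin m)}
    (ht : c.split.symm (t, 0) ∈ c.chart.target) :
    ((c.subChart x₀).symm t : X) = c.chart.symm (c.sect t) := by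
  simp [subChart, c.symm_sect_mem ht]

/-- The change of coordinates on the model space which turns `H` into a linear projection. -/
def straighten : OpenPartialHomeomorph E E where
  toFun A := A + c.τ (c.H A - (c.split A).2)
  invFun A := A + c.τ ((c.split A).2 - c.H A)
  source := c.chart.target
  target := c.chart.target
  map_source' A hA := c.add_mem A hA _
  map_target' A hA := c.add_mem A hA _
  left_inv' A hA := by
    have h1 : (c.split (A + c.τ (c.H A - (c.split A).2))).2 = c.H A := by simp [c.split_τ]
    rw [h1, c.H_add A hA]
    simp only [map_sub, map_add]; abel
  right_inv' A hA := by
    have h1 : (c.split (A + c.τ ((c.split A).2 - c.H A))).2 =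
      (c.split A).2 + ((c.split A).2 - c.H A) := by simp [c.split_τ]
    rw [h1, c.H_add A hA]
    simp only [map_sub, map_add]; abel
  open_source := c.chart.open_target
  open_target := c.chart.open_target
  continuousOn_toFun := by
    have := c.contDiffOn_H.continuousOn
    fun_prop
  continuousOn_invFun := by
    have := c.contDiffOn_H.continuousOn
    fun_prop

lemma contDiffOn_straighten : ContDiffOn ℝ ∞ c.straighten c.chart.target := by
  have := c.contDiffOn_H
  change ContDiffOn ℝ ∞ (fun A => A + c.τ (c.H A - (c.split A).2)) c.chart.target
  fun_prop

lemma contDiffOn_straighten_symm : ContDiffOn ℝ ∞ c.straighten.symm c.chart.target := by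
  have := c.contDiffOn_H
  change ContDiffOn ℝ ∞ (fun A => A + c.τ ((c.split A).2 - c.H A)) c.chart.target
  fun_prop

/-- The straightened chart, in which `O` is a linear subspace. -/
def flatChart : OpenPartialHomeomorph X E := c.chart.trans' c.straighten rfl

lemma flatChart_mem [IsManifold 𝓘(ℝ, E) ∞ X] :
    c.flatChart ∈ IsManifold.maximalAtlas 𝓘(ℝ, E) ∞ X := by
  refine OpenPartialHomeomorph.mem_maximalAtlas_of_contMDiffOn _ ?_ ?_
  · exact c.contDiffOn_straighten.contMDiffOn.comp (contMDiffOn_of_mem_maximalAtlas c.chart_mem)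
      fun y hy => c.chart.map_source hy
  · exact (contMDiffOn_symm_of_mem_maximalAtlas c.chart_mem).comp
      c.contDiffOn_straighten_symm.contMDiffOn fun A hA => c.straighten.map_target hA

/-- The atlas on `O` coming from a family of slice charts around its points. -/
@[reducible] def chartedSpace (C : O → SliceChart (E := E) X F O m)
    (hC : ∀ x, (x : X) ∈ (C x).chart.source) : ChartedSpace (EuclideanSpace ℝ (Fin m)) O where
  atlas := Set.range fun x => (C x).subChart x
  chartAt x := (C x).subChart x
  mem_chart_source := hC
  chart_mem_atlas x := ⟨x, rfl⟩

variable (C : O → SliceChart (E := E) X F O m) (hC : ∀ x, (x : X) ∈ (C x).chart.source)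

lemma isManifold :
    letI := chartedSpace C hC
    IsManifold 𝓘(ℝ, EuclideanSpace ℝ (Fin m)) ∞ O := by
  let := chartedSpace C hC
  refine isManifold_of_contDiffOn _ _ _ ?_
  rintro _ _ ⟨x, rfl⟩ ⟨y, rfl⟩
  have h1 : ContMDiffOn 𝓘(ℝ, EuclideanSpace ℝ (Fin m)) 𝓘(ℝ, EuclideanSpace ℝ (Fin m)) ∞
      (fun t => ((C y).split ((C y).chart ((C x).chart.symm ((C x).sect t)))).1)
      (((C x).subChart x).symm ≫ₕ (C y).subChart y).source := by
    have h2 : ContMDiffOn 𝓘(ℝ, EuclideanSpace ℝ (Fin m)) 𝓘(ℝ, E) ∞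
        (fun t => (C x).chart.symm ((C x).sect t))
        (((C x).subChart x).symm ≫ₕ (C y).subChart y).source :=
      (contMDiffOn_symm_of_mem_maximalAtlas (C x).chart_mem).comp
        ((C x).contDiffOn_sect.contMDiffOn.mono fun t ht => ht.1) fun t ht => (C x).sect_mem ht.1
    refine ((contDiff_fst.comp (C y).split.contDiff).contMDiff).comp_contMDiffOn
      ((contMDiffOn_of_mem_maximalAtlas (C y).chart_mem).comp h2 ?_)
    intro t ht
    have := ht.2
    simp only [Set.mem_preimage] at this
    change (((C x).subChart x).symm t : X) ∈ (C y).chart.source at this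
    rwa [(C x).subChart_symm_apply x ht.1] at this
  refine ((contMDiffOn_iff_contDiffOn.1 h1).mono fun t ht => ht.1).congr fun t ht => ?_
  change ((C y).split ((C y).chart (((C x).subChart x).symm t : X))).1 = _
  exact congrArg (fun z => ((C y).split ((C y).chart z)).1) ((C x).subChart_symm_apply x ht.1.1)

lemma subChart_mem (x : O) :
    letI := chartedSpace C hC
    (C x).subChart x ∈ IsManifold.maximalAtlas 𝓘(ℝ, EuclideanSpace ℝ (Fin m)) ∞ O := by
  let := chartedSpace C hC
  have := isManifold C hC
  exact IsManifold.subset_maximalAtlas ⟨x, rfl⟩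

lemma isSmoothEmbedding [IsManifold 𝓘(ℝ, E) ∞ X] :
    letI := chartedSpace C hC
    Manifold.IsSmoothEmbedding 𝓘(ℝ, EuclideanSpace ℝ (Fin m)) 𝓘(ℝ, E) ∞
      (Subtype.val : O → X) := by
  let := chartedSpace C hC
  refine ⟨Manifold.IsImmersionOfComplement.isImmersion (F := F) fun x => ?_, .subtypeVal⟩
  refine Manifold.IsImmersionAtOfComplement.mk_of_charts (C x).split.symm ((C x).subChart x)
    (C x).flatChart (hC x) (hC x) (subChart_mem C hC x) (C x).flatChart_mem
    (fun y hy => hy) ?_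
  intro t ht
  have ht' : t ∈ ((C x).subChart x).target := by simpa using ht
  replace ht' : (C x).split.symm (t, 0) ∈ (C x).chart.target := ht'
  have hA := (C x).sect_mem ht'
  have h1 : ((((C x).subChart x).symm t : O) : X) = (C x).chart.symm ((C x).sect t) :=
    (C x).subChart_symm_apply x ht'
  change (C x).straighten ((C x).chart (((C x).subChart x).symm t : X)) = (C x).split.symm (t, 0)
  rw [h1, (C x).chart.right_inv hA]
  change (C x).sect t + (C x).τ ((C x).H ((C x).sect t) - ((C x).split ((C x).sect t)).2) = _
  rw [sect, (C x).H_retr ht', ← sect]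
  conv_rhs => rw [← (C x).split_sect t, (C x).symm_split]
  rw [zero_sub, map_neg, sub_eq_add_neg]

/-- The slice diffeomorphism: the retraction onto `O` paired with the defining function. -/
def sliceHomeo (x₀ : O) :
    OpenPartialHomeomorph X (O × F) where
  toFun y := ((c.subChart x₀).symm (c.split (c.chart y)).1, c.H (c.chart y))
  invFun p := c.chart.symm (c.chart p.1 + c.τ p.2)
  source := c.chart.source
  target := {p | (p.1 : X) ∈ c.chart.source}
  map_source' y hy := by
    have hA := c.chart.map_source hy
    change (((c.subChart x₀).symm _ : O) : X) ∈ c.chart.source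
    rw [c.subChart_symm_apply x₀ (c.symm_split_mem hA)]
    exact c.chart.map_target (c.sect_mem (c.symm_split_mem hA))
  map_target' p hp := c.chart.map_target (c.add_mem _ (c.chart.map_source hp) _)
  left_inv' y hy := by
    have hA := c.chart.map_source hy
    dsimp only
    rw [c.subChart_symm_apply x₀ (c.symm_split_mem hA),
      c.chart.right_inv (c.sect_mem (c.symm_split_mem hA)), c.sect_split hA, retr,
      sub_add_cancel, c.chart.left_inv hy]
  right_inv' p hp := by
    have hA := c.chart.map_source hp
    have h0 := (c.mem_iff _ hp).1 p.1.2
    have h1 : (c.split (c.chart p.1 + c.τ p.2)).1 = (c.split (c.chart p.1)).1 := by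
      simp [c.split_τ]
    ext1
    · dsimp only
      rw [c.chart.right_inv (c.add_mem _ hA _), h1]
      exact (c.subChart x₀).left_inv hp
    · dsimp only
      rw [c.chart.right_inv (c.add_mem _ hA _), c.H_add _ hA, h0, zero_add]
  open_source := c.chart.open_source
  open_target := c.chart.open_source.preimage (continuous_subtype_val.comp continuous_fst)
  continuousOn_toFun := by
    refine ContinuousOn.prodMk ((c.subChart x₀).symm.continuousOn.comp ?_ fun y hy =>
      c.symm_split_mem (c.chart.map_source hy)) (c.contDiffOn_H.continuousOn.comp
        c.chart.continuousOn fun y hy => c.chart.map_source hy)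
    exact (continuous_fst.comp c.split.continuous).comp_continuousOn c.chart.continuousOn
  continuousOn_invFun := by
    refine c.chart.symm.continuousOn.comp ?_ fun p hp => c.add_mem _ (c.chart.map_source hp) _
    refine ContinuousOn.add ?_ (by fun_prop)
    exact c.chart.continuousOn.comp (by fun_prop) fun p hp => hp

lemma contMDiffOn_sliceHomeo (x : O) :
    letI := chartedSpace C hC
    ContMDiffOn 𝓘(ℝ, E) (𝓘(ℝ, EuclideanSpace ℝ (Fin m)).prod 𝓘(ℝ, F)) ∞
      ((C x).sliceHomeo x) (C x).chart.source := by
  let := chartedSpace C hC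
  have hc := contMDiffOn_of_mem_maximalAtlas (C x).chart_mem
  refine ContMDiffOn.prodMk ?_ ?_
  · refine (contMDiffOn_symm_of_mem_maximalAtlas (subChart_mem C hC x)).comp (?_ :
      ContMDiffOn _ _ _ (fun y => ((C x).split ((C x).chart y)).1) _) fun y hy =>
      (C x).symm_split_mem ((C x).chart.map_source hy)
    exact (contDiff_fst.comp (C x).split.contDiff).contMDiff.comp_contMDiffOn hc
  · exact (C x).contDiffOn_H.contMDiffOn.comp hc fun y hy => (C x).chart.map_source hy

lemma contMDiffOn_sliceHomeo_symm [IsManifold 𝓘(ℝ, E) ∞ X] (x : O) :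
    letI := chartedSpace C hC
    ContMDiffOn (𝓘(ℝ, EuclideanSpace ℝ (Fin m)).prod 𝓘(ℝ, F)) 𝓘(ℝ, E) ∞
      ((C x).sliceHomeo x).symm ((C x).sliceHomeo x).target := by
  let := chartedSpace C hC
  have hc := contMDiffOn_of_mem_maximalAtlas (C x).chart_mem
  have hv := (isSmoothEmbedding C hC).contMDiff
  refine (contMDiffOn_symm_of_mem_maximalAtlas (C x).chart_mem).comp (?_ :
      ContMDiffOn _ _ _ (fun p : O × F => (C x).chart p.1 + (C x).τ p.2) _) fun p hp =>
      (C x).add_mem _ ((C x).chart.map_source hp) _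
  refine ContMDiffOn.add ?_ ((C x).τ.contDiff.contMDiff.comp_contMDiffOn contMDiffOn_snd)
  exact hc.comp (hv.comp_contMDiffOn contMDiffOn_fst) fun p hp => hp

end SliceChart

end Slice

/-! ### Signatures of quadratic forms -/

lemma hasSignature_iff_of_equivalent {M M' : Type*} [AddCommGroup M] [Module ℝ M]
    [AddCommGroup M'] [Module ℝ M'] {Q : QuadraticForm ℝ M} {Q' : QuadraticForm ℝ M'}
    (h : QuadraticMap.Equivalent Q Q') (a b : ℕ) : HasSignature Q a b ↔ HasSignature Q' a b := by
  rw [HasSignature, HasSignature, h.sigPos_eq, h.sigNeg_eq]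

lemma hasSignature_weightedSumSquares {ι : Type*} [Fintype ι] (w : ι → ℝ) :
    HasSignature (QuadraticMap.weightedSumSquares ℝ w) {i | 0 < w i}.ncard {i | w i < 0}.ncard :=
  ⟨QuadraticForm.sigPos_weightedSumSquares, QuadraticForm.sigNeg_weightedSumSquares⟩

/-- The signature is additive on orthogonal sums. -/
lemma HasSignature.prod {M M' : Type*} [AddCommGroup M] [Module ℝ M] [FiniteDimensional ℝ M]
    [AddCommGroup M'] [Module ℝ M'] [FiniteDimensional ℝ M'] {Q : QuadraticForm ℝ M}
    {Q' : QuadraticForm ℝ M'} {a b a' b' : ℕ} (h : HasSignature Q a b)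
    (h' : HasSignature Q' a' b') : HasSignature (Q.prod Q') (a + a') (b + b') := by
  obtain ⟨w, e⟩ := Q.equivalent_weightedSumSquares
  obtain ⟨w', e'⟩ := Q'.equivalent_weightedSumSquares
  have key : QuadraticMap.Equivalent ((QuadraticMap.weightedSumSquares ℝ w).prod
      (QuadraticMap.weightedSumSquares ℝ w')) (QuadraticMap.weightedSumSquares ℝ (Sum.elim w w')) :=
    ⟨⟨(LinearEquiv.sumArrowLequivProdArrow _ _ ℝ ℝ).symm, fun x => by
      simp only [QuadraticMap.weightedSumSquares_apply, QuadraticMap.prod_apply,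
        Fintype.sum_sum_type]
      rfl⟩⟩
  rw [hasSignature_iff_of_equivalent ((e.prod e').trans key)]
  rw [hasSignature_iff_of_equivalent e] at h
  rw [hasSignature_iff_of_equivalent e'] at h'
  have h1 := hasSignature_weightedSumSquares w
  have h2 := hasSignature_weightedSumSquares w'
  have h3 := hasSignature_weightedSumSquares (Sum.elim w w')
  have cnt : ∀ P : ℝ → Prop, {i | P (Sum.elim w w' i)}.ncard =
      {i | P (w i)}.ncard + {i | P (w' i)}.ncard := by
    intro P
    have : {i | P (Sum.elim w w' i)} = Sum.inl '' {i | P (w i)} ∪ Sum.inr '' {i | P (w' i)} := by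
      ext i; rcases i with i | i <;> simp
    rw [this, Set.ncard_union_eq, Set.ncard_image_of_injective _ Sum.inl_injective,
      Set.ncard_image_of_injective _ Sum.inr_injective]
    rw [Set.disjoint_left]
    rintro _ ⟨i, -, rfl⟩ ⟨j, -, h⟩
    cases h
  rw [cnt (fun x => 0 < x), cnt (fun x => x < 0)] at h3
  rw [← h.1, ← h.2, ← h'.1, ← h'.2]
  exact ⟨h3.1.trans (by rw [h1.1, h2.1]), h3.2.trans (by rw [h1.2, h2.2])⟩

lemma toQuadraticForm'_apply {p : Type*} [Fintype p] [DecidableEq p] (G : Matrix p p ℝ)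
    (v : p → ℝ) : G.toQuadraticForm' v = v ⬝ᵥ G *ᵥ v := by
  simp [Matrix.toQuadraticForm', LinearMap.BilinMap.toQuadraticMap_apply,
    Matrix.toLinearMap₂'_apply']

/-- Completing the square: a symmetric block matrix is congruent to the sum of its upper left block
and the Schur complement. -/
lemma equivalent_schur {p q : Type*} [Fintype p] [DecidableEq p] [Fintype q] [DecidableEq q]
    {A : Matrix p p ℝ} (B : Matrix p q ℝ) (D : Matrix q q ℝ) (hA : A.IsHermitian)
    (hdet : IsUnit A.det) :
    QuadraticMap.Equivalent (Matrix.fromBlocks A B Bᵀ D).toQuadraticForm'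
      (A.toQuadraticForm'.prod (D - Bᵀ * A⁻¹ * B).toQuadraticForm') := by
  let : Invertible A := A.invertibleOfIsUnitDet hdet
  let f : (p ⊕ q → ℝ) ≃ₗ[ℝ] (p → ℝ) × (q → ℝ) :=
    { toFun := fun u => (u ∘ Sum.inl + (A⁻¹ * B) *ᵥ (u ∘ Sum.inr), u ∘ Sum.inr)
      invFun := fun x => Sum.elim (x.1 - (A⁻¹ * B) *ᵥ x.2) x.2
      map_add' := fun u v => by
        ext i
        · simp [Pi.add_comp, Matrix.mulVec_add]; ring
        · simp
      map_smul' := fun t u => by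
        ext i
        · simp [Pi.smul_comp, Matrix.mulVec_smul]
        · simp
      left_inv := fun u => by ext i; rcases i with i | i <;> simp
      right_inv := fun x => by ext i <;> simp }
  refine ⟨⟨f, fun u => ?_⟩⟩
  have h := Matrix.schur_complement_eq₁₁ B D (u ∘ Sum.inl) (u ∘ Sum.inr) hA
  simp only [star_trivial, Matrix.conjTranspose_eq_transpose_of_trivial,
    Sum.elim_comp_inl_inr] at h
  simp only [QuadraticMap.prod_apply, toQuadraticForm'_apply]
  change (f u).1 ⬝ᵥ A *ᵥ (f u).1 + (f u).2 ⬝ᵥ (D - Bᵀ * A⁻¹ * B) *ᵥ (f u).2 = _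
  simp only [Matrix.dotProduct_mulVec]
  exact h.symm

/-- A matrix close to the identity is positive definite. -/
lemma pos_of_close_one {p : Type*} [Fintype p] [DecidableEq p] {G : Matrix p p ℝ}
    (hG : ∀ i j, |G i j - (1 : Matrix p p ℝ) i j| < (Fintype.card p + 1 : ℝ)⁻¹) {v : p → ℝ}
    (hv : v ≠ 0) : 0 < v ⬝ᵥ G *ᵥ v := by
  set δ : ℝ := (Fintype.card p + 1 : ℝ)⁻¹ with hδ
  have h1 : v ⬝ᵥ G *ᵥ v = ∑ i, v i ^ 2 + ∑ i, ∑ j, v i * (G i j - (1 : Matrix p p ℝ) i j) * v j := by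
    have h0 : ∑ i, v i ^ 2 = v ⬝ᵥ (1 : Matrix p p ℝ) *ᵥ v := by
      rw [Matrix.one_mulVec]; exact Finset.sum_congr rfl fun i _ => pow_two _
    rw [h0, ← sub_eq_iff_eq_add', ← dotProduct_sub, ← Matrix.sub_mulVec]
    simp only [dotProduct, Matrix.mulVec, Finset.mul_sum, Matrix.sub_apply, mul_assoc]
  have h2 : |∑ i, ∑ j, v i * (G i j - (1 : Matrix p p ℝ) i j) * v j| ≤ δ * (∑ i, |v i|) ^ 2 := by
    calc |∑ i, ∑ j, v i * (G i j - (1 : Matrix p p ℝ) i j) * v j|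
        ≤ ∑ i, ∑ j, |v i * (G i j - (1 : Matrix p p ℝ) i j) * v j| :=
          (Finset.abs_sum_le_sum_abs _ _).trans
            (Finset.sum_le_sum fun i _ => Finset.abs_sum_le_sum_abs _ _)
      _ ≤ ∑ i, ∑ j, δ * (|v i| * |v j|) := by
          refine Finset.sum_le_sum fun i _ => Finset.sum_le_sum fun j _ => ?_
          rw [abs_mul, abs_mul]
          have := mul_le_mul_of_nonneg_right (hG i j).le
            (mul_nonneg (abs_nonneg (v i)) (abs_nonneg (v j)))
          linarith
      _ = δ * (∑ i, |v i|) ^ 2 := by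
          rw [pow_two, Finset.sum_mul_sum, Finset.mul_sum]
          simp only [Finset.mul_sum]
  have h3 : (∑ i, |v i|) ^ 2 ≤ Fintype.card p * ∑ i, v i ^ 2 := by
    simpa using sq_sum_le_card_mul_sum_sq (s := Finset.univ) (f := fun i => |v i|)
  have h4 : 0 < ∑ i, v i ^ 2 := by
    obtain ⟨i, hi⟩ := Function.ne_iff.1 hv
    exact Finset.sum_pos' (fun i _ => sq_nonneg _) ⟨i, Finset.mem_univ i, sq_pos_of_ne_zero hi⟩
  have hδ0 : 0 < δ := by positivity
  have h5 : δ * Fintype.card p < 1 := by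
    rw [hδ, inv_mul_lt_iff₀ (by positivity)]; simp
  have h6 := mul_le_mul_of_nonneg_left h3 hδ0.le
  have h7 := mul_lt_mul_of_pos_right h5 h4
  rw [h1]
  have := neg_abs_le (∑ i, ∑ j, v i * (G i j - (1 : Matrix p p ℝ) i j) * v j)
  linarith

/-- The diagonal signs `1, …, 1, -1, …, -1`. -/
def sgn (r s : ℕ) : Fin r ⊕ Fin s → ℝ := Sum.elim (fun _ => 1) (fun _ => -1)

lemma sgn_mul_self {r s : ℕ} (i : Fin r ⊕ Fin s) : sgn r s i * sgn r s i = 1 := by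
  rcases i with i | i <;> simp [sgn]

/-- The matrices whose entries are close to those of the standard form of signature `(r, s)`. -/
def NearSgn (r s : ℕ) (G : Matrix (Fin r ⊕ Fin s) (Fin r ⊕ Fin s) ℝ) : Prop :=
  ∀ i j, |sgn r s i * G i j - (1 : Matrix _ _ ℝ) i j| < (Fintype.card (Fin r ⊕ Fin s) + 1 : ℝ)⁻¹

lemma NearSgn.pos {r s : ℕ} {G : Matrix (Fin r ⊕ Fin s) (Fin r ⊕ Fin s) ℝ} (hG : NearSgn r s G)
    {v : Fin r ⊕ Fin s → ℝ} (hv : v ≠ 0) : 0 < ∑ i, sgn r s i * v i * (G *ᵥ v) i := by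
  have := pos_of_close_one (G := Matrix.of fun i j => sgn r s i * G i j) hG hv
  refine this.trans_eq (Finset.sum_congr rfl fun i _ => ?_)
  simp only [Matrix.mulVec, dotProduct, Matrix.of_apply, Finset.mul_sum]
  exact Finset.sum_congr rfl fun j _ => by ring

lemma NearSgn.isUnit_det {r s : ℕ} {G : Matrix (Fin r ⊕ Fin s) (Fin r ⊕ Fin s) ℝ}
    (hG : NearSgn r s G) : IsUnit G.det := by
  rw [isUnit_iff_ne_zero]
  intro h
  obtain ⟨v, hv, h0⟩ := Matrix.exists_mulVec_eq_zero_iff.2 h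
  have := hG.pos hv
  simp [h0] at this

lemma NearSgn.hasSignature {r s : ℕ} {G : Matrix (Fin r ⊕ Fin s) (Fin r ⊕ Fin s) ℝ}
    (hG : NearSgn r s G) : HasSignature G.toQuadraticForm' r s := by
  have dimr : Module.finrank ℝ (Pi.spanSubset ℝ (Set.range (Sum.inl : Fin r → Fin r ⊕ Fin s))) = r := by
    rw [Pi.dim_spanSubset, ← Nat.card_coe_set_eq, Nat.card_range_of_injective Sum.inl_injective]
    simp
  have dims : Module.finrank ℝ (Pi.spanSubset ℝ (Set.range (Sum.inr : Fin s → Fin r ⊕ Fin s))) = s := by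
    rw [Pi.dim_spanSubset, ← Nat.card_coe_set_eq, Nat.card_range_of_injective Sum.inr_injective]
    simp
  have hr : r ≤ sigPos G.toQuadraticForm' := by
    refine dimr.symm.le.trans ?_
    refine le_sigPos_of_posDef _ fun v hv => ?_
    rw [QuadraticMap.restrict_apply, toQuadraticForm'_apply]
    refine (hG.pos (v := v) (by simpa using hv)).trans_eq (Finset.sum_congr rfl fun i _ => ?_)
    have hv2 := Pi.mem_spanSubset_iff.1 v.2
    rcases i with i | i
    · simp [sgn]
    · simp [hv2 (Sum.inr i) (by simp)]
  have hs : s ≤ sigNeg G.toQuadraticForm' := by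
    refine dims.symm.le.trans ?_
    refine le_sigNeg_of_negDef _ fun v hv => ?_
    rw [QuadraticMap.restrict_apply, neg_apply, toQuadraticForm'_apply, dotProduct,
      ← Finset.sum_neg_distrib]
    refine (hG.pos (v := v) (by simpa using hv)).trans_eq (Finset.sum_congr rfl fun i _ => ?_)
    have hv2 := Pi.mem_spanSubset_iff.1 v.2
    rcases i with i | i
    · simp [hv2 (Sum.inl i) (by simp)]
    · simp [sgn]
  have htot := QuadraticForm.sigPos_add_sigNeg_add_radical (Q := G.toQuadraticForm')
  simp only [Module.finrank_fintype_fun_eq_card, Fintype.card_sum, Fintype.card_fin] at htot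
  exact ⟨by omega, by omega⟩

variable {n : ℕ}

/-! ### The bilinear form, complex conjugation and maximality -/

lemma bForm_apply (z w : Cn n) : bForm n z w = ∑ i, z i * w i := rfl

lemma bForm_comm (z w : Cn n) : bForm n z w = bForm n w z := by
  simp only [bForm_apply, mul_comm]

lemma reForm_apply (z w : Cn n) : reForm n z w = (bForm n z w).re := rfl

lemma imForm_apply' (z w : Cn n) : imForm n z w = (bForm n z w).im := rfl

/-- Complex conjugation on `ℂⁿ`. -/
def conjVec (z : Cn n) : Cn n := conjFlip n (Complex.I • z)

lemma conjVec_apply (z : Cn n) (i : Fin n) : conjVec z i = (starRingEnd ℂ) (z i) := by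
  rw [conjVec, conjFlip_apply, PiLp.smul_apply, smul_eq_mul, map_mul, Complex.conj_I, ← mul_assoc,
    mul_neg, Complex.I_mul_I, neg_neg, one_mul]

lemma inner_eq_sum (z w : Cn n) : inner ℂ z w = ∑ i, (starRingEnd ℂ) (z i) * w i := by
  rw [PiLp.inner_apply]
  exact Finset.sum_congr rfl fun i _ => by rw [RCLike.inner_apply, mul_comm]

lemma bForm_conjVec (z w : Cn n) : bForm n z (conjVec w) = inner ℂ w z := by
  rw [bForm_apply, inner_eq_sum]
  exact Finset.sum_congr rfl fun i _ => by rw [conjVec_apply, mul_comm]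

lemma bForm_conjVec_conjVec (z w : Cn n) :
    bForm n (conjVec z) (conjVec w) = (starRingEnd ℂ) (bForm n z w) := by
  simp [bForm_apply, conjVec_apply]

lemma inner_conjVec (z w : Cn n) : inner ℂ z (conjVec w) = (starRingEnd ℂ) (bForm n z w) := by
  simp [inner_eq_sum, bForm_apply, conjVec_apply]

lemma inner_conjFlip (z w : Cn n) :
    inner ℂ z (conjFlip n w) = Complex.I * (starRingEnd ℂ) (bForm n z w) := by
  simp only [inner_eq_sum, bForm_apply, conjFlip_apply, map_sum, map_mul, Finset.mul_sum]
  exact Finset.sum_congr rfl fun i _ => by ring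

lemma real_inner_eq_re (z w : Cn n) : ⟪z, w⟫_ℝ = (inner ℂ z w).re := by
  rw [inner_eq_sum, PiLp.inner_apply, Complex.re_sum]
  exact Finset.sum_congr rfl fun i _ => by rw [Complex.inner, mul_comm]

lemma bForm_smul_real (t : ℝ) (z w : Cn n) : bForm n (t • z) w = t * bForm n z w := by
  simp [bForm_apply, Finset.mul_sum]

lemma inner_smul_ofReal (z w : Cn n) (t : ℝ) : inner ℂ z (t • w) = t * inner ℂ z w := by
  simp [inner_eq_sum, Finset.mul_sum]

lemma smul_eq_re_add_im (c : ℂ) (z : Cn n) : c • z = c.re • z + c.im • (Complex.I • z) := by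
  conv_lhs => rw [← Complex.re_add_im c]
  rw [add_smul, mul_smul]
  rfl

namespace MaxIso

variable (L : MaxIso n)

lemma bForm_im {v w : Cn n} (hv : v ∈ L.V) (hw : w ∈ L.V) : (bForm n v w).im = 0 :=
  L.isotropic v hv w hw

lemma bForm_eq_reForm {v w : Cn n} (hv : v ∈ L.V) (hw : w ∈ L.V) :
    bForm n v w = (reForm n v w : ℝ) :=
  Complex.ext rfl (L.bForm_im hv hw)

lemma frame_coframe {z : Cn n} (hz : z ∈ L.V) : L.frame (L.coframe z) = z := by
  obtain ⟨x, rfl⟩ := L.exists_frame hz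
  rw [L.coframe_frame]

/-- A maximal isotropic subspace is its own orthogonal complement. -/
lemma mem_of_imForm {z : Cn n} (h : ∀ v ∈ L.V, imForm n z v = 0) : z ∈ L.V := by
  have h0 : L.coframe (conjFlip n z) = 0 := by
    refine ext_inner_right ℝ fun x => ?_
    rw [L.coframe_inner, ← imForm_eq, h _ (L.frame_mem x), inner_zero_left]
  rw [L.decomp z, h0]
  simpa using L.frame_mem _

/-- The vector of the graph of `A` over a vector of `L`. -/
def lift (A : Rn n →L[ℝ] Rn n) : Cn n →ₗ[ℝ] Cn n :=
  (L.graphMap A).toLinearMap ∘ₗ L.coframe.toLinearMap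

lemma lift_apply (A : Rn n →L[ℝ] Rn n) (z : Cn n) : L.lift A z = L.graphMap A (L.coframe z) := rfl

lemma lift_mem (A : Skew n) (z : Cn n) : L.lift A z ∈ (L.graph A).V := L.graphMap_mem A _

lemma lift_eq (A : Rn n →L[ℝ] Rn n) {z : Cn n} (hz : z ∈ L.V) :
    L.lift A z = z + conjFlip n (L.frame (A (L.coframe z))) := by
  rw [lift_apply, graphMap_apply, L.frame_coframe hz]

lemma lift_zero {z : Cn n} (hz : z ∈ L.V) : L.lift 0 z = z := by
  simp [L.lift_eq 0 hz]

lemma graph_zero : L.graph 0 = L := by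
  symm
  refine eq_of_le fun z hz => ?_
  have := L.lift_mem 0 z
  rwa [ZeroMemClass.coe_zero, L.lift_zero hz] at this

lemma lift_injOn (A : Rn n →L[ℝ] Rn n) : Set.InjOn (L.lift A) L.V := by
  intro z hz w hw h
  have : L.coframe z = L.coframe w := L.graphMap_injective A h
  rw [← L.frame_coframe hz, this, L.frame_coframe hw]

end MaxIso

/-! ### Adapted frames -/

/-- A frame of `L` adapted to the form `b`: the vectors `w` are orthonormal of type `(r, s)` for the
real form `b|_L`, the vectors `e` are a unitary basis of the radical of `b|_L`, which is a complex
subspace of `ℂⁿ`, and the two families are orthogonal for the Hermitian inner product. -/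
structure Frame (L : MaxIso n) (r s k : ℕ) where
  w : Fin r ⊕ Fin s → Cn n
  e : Fin k → Cn n
  card : n = r + s + 2 * k
  w_mem : ∀ i, w i ∈ L.V
  e_mem : ∀ j, e j ∈ L.V
  I_smul_e_mem : ∀ j, Complex.I • e j ∈ L.V
  bForm_ww : ∀ i j, bForm n (w i) (w j) = if i = j then (sgn r s i : ℂ) else 0
  inner_ee : ∀ i j, inner ℂ (e i) (e j) = if i = j then (1 : ℂ) else 0
  inner_ew : ∀ i j, inner ℂ (e i) (w j) = 0

namespace Frame

variable {L : MaxIso n} {r s k : ℕ} (F : Frame L r s k)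

lemma bForm_e (j : Fin k) {v : Cn n} (hv : v ∈ L.V) : bForm n (F.e j) v = 0 := by
  refine Complex.ext ?_ (L.bForm_im (F.e_mem j) hv)
  have := L.bForm_im (F.I_smul_e_mem j) hv
  simpa using this

lemma bForm_e' (j : Fin k) {v : Cn n} (hv : v ∈ L.V) : bForm n v (F.e j) = 0 := by
  rw [bForm_comm, F.bForm_e j hv]

/-- The vectors of the frame, as a real basis of `L`. -/
def vec : (Fin r ⊕ Fin s) ⊕ (Fin k ⊕ Fin k) → Cn n :=
  Sum.elim F.w (Sum.elim F.e fun j => Complex.I • F.e j)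

lemma vec_mem (a) : F.vec a ∈ L.V := by
  rcases a with i | j | j
  · exact F.w_mem i
  · exact F.e_mem j
  · exact F.I_smul_e_mem j

lemma smul_e_mem (c : ℂ) (j : Fin k) : c • F.e j ∈ L.V := by
  rw [smul_eq_re_add_im]
  exact L.V.add_mem (L.V.smul_mem _ (F.e_mem j)) (L.V.smul_mem _ (F.I_smul_e_mem j))

lemma inner_e_lift (A : Rn n →L[ℝ] Rn n) (j : Fin k) {z : Cn n} (hz : z ∈ L.V) :
    inner ℂ (F.e j) (L.lift A z) = inner ℂ (F.e j) z := by
  rw [L.lift_eq A hz, inner_add_right, inner_conjFlip, F.bForm_e j (L.frame_mem _)]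
  simp

lemma linearIndependent_vec : LinearIndependent ℝ F.vec := by
  rw [Fintype.linearIndependent_iff]
  intro u hu
  simp only [Fintype.sum_sum_type, vec, Sum.elim_inl, Sum.elim_inr] at hu
  have hu' : ∑ i, u (.inl (.inl i)) • F.w (.inl i) + ∑ i, u (.inl (.inr i)) • F.w (.inr i) =
    ∑ i, u (.inl i) • F.w i := by rw [Fintype.sum_sum_type]
  rw [hu'] at hu
  have h1 : ∀ i, u (.inl i) = 0 := by
    intro i
    have := congrArg (fun z => bForm n z (F.w i)) hu
    simp only [map_add, map_sum, LinearMap.add_apply, LinearMap.sum_apply, bForm_smul_real,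
      F.bForm_ww, F.bForm_e _ (F.w_mem i), map_smul, LinearMap.smul_apply, smul_zero,
      Finset.sum_const_zero, mul_zero, add_zero, mul_ite, Finset.sum_ite_eq', Finset.mem_univ,
      if_true, map_zero, LinearMap.zero_apply] at this
    have hs : (sgn r s i : ℂ) ≠ 0 := by
      intro h0
      have := sgn_mul_self i
      rw [Complex.ofReal_eq_zero.1 h0] at this
      simp at this
    simpa [hs] using this
  have h2 : ∀ j, u (.inr (.inl j)) = 0 ∧ u (.inr (.inr j)) = 0 := by
    intro j
    have := congrArg (fun z => inner ℂ (F.e j) z) hu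
    simp only [h1, zero_smul, Finset.sum_const_zero, zero_add, inner_add_right, inner_sum,
      inner_zero_right, inner_smul_ofReal, inner_smul_right, F.inner_ee] at this
    have h3 := congrArg Complex.re this
    have h4 := congrArg Complex.im this
    simp at h3 h4
    exact ⟨h3, h4⟩
  rintro (i | j | j)
  exacts [h1 i, (h2 j).1, (h2 j).2]

end Frame

/-! ### The Gram matrix of a graph and its Schur complement -/

/-- In a basis of `K`, the form `Re b|_K` is given by its Gram matrix. -/
lemma equivalent_gram (K : MaxIso n) {ι : Type*} [Fintype ι] [DecidableEq ι] (v : ι → Cn n)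
    (hv : ∀ i, v i ∈ K.V) (hli : LinearIndependent ℝ v) (hcard : Fintype.card ι = n) :
    QuadraticMap.Equivalent
      (Matrix.of fun i j => reForm n (v i) (v j)).toQuadraticForm' (reQuad K.V) := by
  have hli' : LinearIndependent ℝ (fun i => (⟨v i, hv i⟩ : K.V)) :=
    LinearIndependent.of_comp K.V.subtype hli
  let f : (ι → ℝ) →ₗ[ℝ] K.V := Fintype.linearCombination ℝ (fun i => (⟨v i, hv i⟩ : K.V))
  have hinj : Function.Injective f := hli'.fintypeLinearCombination_injective
  have hdim : Module.finrank ℝ (ι → ℝ) = Module.finrank ℝ K.V := by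
    rw [K.finrank_eq, Module.finrank_fintype_fun_eq_card, hcard]
  refine ⟨⟨LinearEquiv.ofInjectiveOfFinrankEq f hinj hdim, fun u => ?_⟩⟩
  have hf : ((f u : K.V) : Cn n) = ∑ i, u i • v i := by
    simp [f, Fintype.linearCombination_apply]
  change reQuad K.V (f u) = _
  rw [reQuad, QuadraticMap.restrict_apply, LinearMap.BilinMap.toQuadraticMap_apply, hf,
    toQuadraticForm'_apply]
  simp only [map_sum, map_smul, LinearMap.sum_apply, LinearMap.smul_apply, smul_eq_mul, dotProduct,
    Matrix.mulVec, Matrix.of_apply, Finset.mul_sum]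
  rw [Finset.sum_comm]
  exact Finset.sum_congr rfl fun i _ => Finset.sum_congr rfl fun j _ => by ring

namespace Frame

variable {L : MaxIso n} {r s k : ℕ} (F : Frame L r s k)

/-- The Gram matrix of `Re b` on the graph of `A`, in the basis lifted from the frame of `L`. -/
def gramMat (A : Rn n →L[ℝ] Rn n) :
    Matrix ((Fin r ⊕ Fin s) ⊕ (Fin k ⊕ Fin k)) ((Fin r ⊕ Fin s) ⊕ (Fin k ⊕ Fin k)) ℝ :=
  Matrix.of fun a c => reForm n (L.lift A (F.vec a)) (L.lift A (F.vec c))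

/-- The Schur complement of the nondegenerate block of the Gram matrix. -/
def schur (A : Rn n →L[ℝ] Rn n) : Matrix (Fin k ⊕ Fin k) (Fin k ⊕ Fin k) ℝ :=
  (F.gramMat A).toBlocks₂₂ -
    (F.gramMat A).toBlocks₁₂ᵀ * (F.gramMat A).toBlocks₁₁⁻¹ * (F.gramMat A).toBlocks₁₂

lemma gramMat_comm (A : Rn n →L[ℝ] Rn n) (a c) : F.gramMat A a c = F.gramMat A c a := by
  simp only [gramMat, Matrix.of_apply, reForm_apply]
  rw [bForm_comm]

lemma gramMat_eq_fromBlocks (A : Rn n →L[ℝ] Rn n) :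
    F.gramMat A = Matrix.fromBlocks (F.gramMat A).toBlocks₁₁ (F.gramMat A).toBlocks₁₂
      (F.gramMat A).toBlocks₁₂ᵀ (F.gramMat A).toBlocks₂₂ := by
  have : (F.gramMat A).toBlocks₁₂ᵀ = (F.gramMat A).toBlocks₂₁ := by
    ext i j
    exact F.gramMat_comm A _ _
  rw [this, Matrix.fromBlocks_toBlocks]

lemma isHermitian_block (A : Rn n →L[ℝ] Rn n) : ((F.gramMat A).toBlocks₁₁).IsHermitian := by
  ext i j
  exact F.gramMat_comm A _ _

lemma card_index (F : Frame L r s k) : Fintype.card ((Fin r ⊕ Fin s) ⊕ (Fin k ⊕ Fin k)) = n := by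
  have := F.card
  simp only [Fintype.card_sum, Fintype.card_fin]; omega

lemma linearIndependent_lift (A : Skew n) :
    LinearIndependent ℝ fun a => L.lift A (F.vec a) := by
  refine F.linearIndependent_vec.map_injOn (L.lift A) ?_
  refine (L.lift_injOn A).mono ?_
  exact Submodule.span_le.2 (Set.range_subset_iff.2 F.vec_mem)

/-- The signature of `Re b` on a graph is that of the Schur complement, shifted by `(r, s)`, because
the nondegenerate block of the Gram matrix still has signature `(r, s)`. -/
lemma hasSignature_graph (A : Skew n) (hA : NearSgn r s (F.gramMat A).toBlocks₁₁) {a c : ℕ}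
    (h : HasSignature (F.schur A).toQuadraticForm' a c) :
    HasSignature (reQuad (L.graph A).V) (r + a) (s + c) := by
  have e1 : QuadraticMap.Equivalent (F.gramMat A).toQuadraticForm' (reQuad (L.graph A).V) :=
    equivalent_gram (L.graph A) _ (fun a => L.lift_mem A _) (F.linearIndependent_lift A) F.card_index
  rw [F.gramMat_eq_fromBlocks] at e1
  rw [← hasSignature_iff_of_equivalent e1, hasSignature_iff_of_equivalent
    (equivalent_schur _ _ (F.isHermitian_block A) hA.isUnit_det)]
  exact hA.hasSignature.prod h

/-! ### The Schur complement is Hermitian -/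

/-- The vectors of `ℂⁿ` which are orthogonal to the radical of `b|_L` for the Hermitian inner
product and to the lifted `w`-vectors for `b` lie in the conjugate of the radical, on which `b`
vanishes. -/
lemma bForm_eq_zero_of_orthogonal (A : Skew n) (hA : IsUnit ((F.gramMat A).toBlocks₁₁).det)
    {y z : Cn n} (hy : ∀ j, inner ℂ (F.e j) y = 0) (hy' : ∀ i, bForm n y (L.lift A (F.w i)) = 0)
    (hz : ∀ j, inner ℂ (F.e j) z = 0) (hz' : ∀ i, bForm n z (L.lift A (F.w i)) = 0) :
    bForm n y z = 0 := by
  -- The lifted `w`-vectors, the `e`-vectors and their conjugates form a complex basis of `ℂⁿ`: they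
  -- are `r + s + 2k = n` vectors, and the given orthogonality relations isolate the coordinates.
  let T : ((Fin r ⊕ Fin s → ℂ) × (Fin k → ℂ) × (Fin k → ℂ)) →ₗ[ℂ] Cn n :=
    LinearMap.coprod (Fintype.linearCombination ℂ fun i => L.lift A (F.w i))
      (LinearMap.coprod (Fintype.linearCombination ℂ F.e)
        (Fintype.linearCombination ℂ fun j => conjVec (F.e j)))
  have hT : ∀ x, T x = ∑ i, x.1 i • L.lift A (F.w i) +
      (∑ j, x.2.1 j • F.e j + ∑ j, x.2.2 j • conjVec (F.e j)) := fun x => by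
    simp [T, Fintype.linearCombination_apply]
  have hee : ∀ j l, bForm n (F.e j) (F.e l) = 0 := fun j l => F.bForm_e j (F.e_mem l)
  have hew : ∀ j i, inner ℂ (F.e j) (L.lift A (F.w i)) = 0 := fun j i => by
    rw [F.inner_e_lift A j (F.w_mem i), F.inner_ew]
  have hinner : ∀ x j, inner ℂ (F.e j) (T x) = x.2.1 j := by
    intro x j
    rw [hT]
    simp only [inner_add_right, inner_sum, inner_smul_right, hew, inner_conjVec, hee, map_zero,
      F.inner_ee]
    simp
  have hw : ∀ x i, bForm n (T x) (L.lift A (F.w i)) =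
      ∑ l, x.1 l * ((F.gramMat A).toBlocks₁₁ l i : ℂ) +
        ∑ j, x.2.1 j * bForm n (F.e j) (L.lift A (F.w i)) := by
    intro x i
    rw [hT]
    simp only [map_add, map_sum, map_smul, LinearMap.add_apply, LinearMap.sum_apply,
      LinearMap.smul_apply, smul_eq_mul]
    congr 1
    · refine Finset.sum_congr rfl fun l _ => ?_
      rw [(L.graph A).bForm_eq_reForm (L.lift_mem A _) (L.lift_mem A _)]
      rfl
    · rw [add_eq_left]
      refine Finset.sum_eq_zero fun j _ => ?_
      rw [bForm_comm, bForm_conjVec, hew, mul_zero]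
  have key : ∀ x, (∀ j, inner ℂ (F.e j) (T x) = 0) →
      (∀ i, bForm n (T x) (L.lift A (F.w i)) = 0) → x.1 = 0 ∧ x.2.1 = 0 := by
    intro x h1 h2
    have h3 : x.2.1 = 0 := funext fun j => by rw [← hinner, h1]; rfl
    refine ⟨?_, h3⟩
    have h4 : x.1 ᵥ* ((F.gramMat A).toBlocks₁₁.map Complex.ofRealHom) = 0 := by
      ext i
      have := hw x i
      rw [h2, h3] at this
      simpa [Matrix.vecMul, dotProduct] using this.symm
    refine Matrix.eq_zero_of_vecMul_eq_zero ?_ h4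
    rw [← RingHom.mapMatrix_apply, ← RingHom.map_det]
    exact fun h0 => hA.ne_zero (by simpa using h0)
  have hinj : Function.Injective T := by
    refine (injective_iff_map_eq_zero T).2 fun x hx => ?_
    obtain ⟨h1, h2⟩ := key x (by simp [hx]) (by simp [hx])
    have h3 : x.2.2 = 0 := by
      funext j
      have := congrArg (fun z => bForm n z (F.e j)) (hT x)
      simp only [hx, h1, h2, map_zero, LinearMap.zero_apply, Pi.zero_apply, zero_smul,
        Finset.sum_const_zero, zero_add, map_sum, map_smul, LinearMap.sum_apply,
        LinearMap.smul_apply, smul_eq_mul] at this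
      simp only [bForm_comm _ (F.e j), bForm_conjVec, F.inner_ee] at this
      simpa using this.symm
    exact Prod.ext h1 (Prod.ext h2 h3)
  have hsurj : Function.Surjective T := by
    refine (LinearMap.injective_iff_surjective_of_finrank_eq_finrank ?_).1 hinj
    have := F.card
    simp; omega
  obtain ⟨x, rfl⟩ := hsurj y
  obtain ⟨x', rfl⟩ := hsurj z
  obtain ⟨h1, h2⟩ := key x hy hy'
  obtain ⟨h1', h2'⟩ := key x' hz hz'
  rw [hT, hT, h1, h2, h1', h2']
  simp [bForm_conjVec_conjVec, hee]

/-- The basis vectors of the orthogonal complement of the nondegenerate part of the graph. -/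
def schurVec (A : Rn n →L[ℝ] Rn n) (a : Fin k ⊕ Fin k) : Cn n :=
  L.lift A (F.vec (.inr a)) -
    ∑ i, ((F.gramMat A).toBlocks₁₁⁻¹ * (F.gramMat A).toBlocks₁₂) i a • L.lift A (F.w i)

lemma schurVec_mem (A : Skew n) (a : Fin k ⊕ Fin k) : F.schurVec A a ∈ (L.graph A).V :=
  Submodule.sub_mem _ (L.lift_mem A _)
    (Submodule.sum_mem _ fun _ _ => Submodule.smul_mem _ _ (L.lift_mem A _))

lemma reForm_schurVec_w (A : Rn n →L[ℝ] Rn n) (hA : IsUnit ((F.gramMat A).toBlocks₁₁).det)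
    (a : Fin k ⊕ Fin k) (i : Fin r ⊕ Fin s) :
    reForm n (F.schurVec A a) (L.lift A (F.w i)) = 0 := by
  have h1 : ∑ l, ((F.gramMat A).toBlocks₁₁⁻¹ * (F.gramMat A).toBlocks₁₂) l a *
      (F.gramMat A).toBlocks₁₁ i l = (F.gramMat A).toBlocks₁₂ i a := by
    have := congrFun (congrFun (Matrix.mul_nonsing_inv_cancel_left (F.gramMat A).toBlocks₁₁
      (F.gramMat A).toBlocks₁₂ hA) i) a
    rw [Matrix.mul_apply] at this
    rw [← this]
    exact Finset.sum_congr rfl fun l _ => mul_comm _ _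
  rw [schurVec, map_sub, LinearMap.sub_apply, map_sum, LinearMap.sum_apply]
  simp only [map_smul, LinearMap.smul_apply, smul_eq_mul]
  have h2 : ∀ l, reForm n (L.lift A (F.w l)) (L.lift A (F.w i)) =
    (F.gramMat A).toBlocks₁₁ i l := fun l => F.gramMat_comm A (.inl l) (.inl i)
  simp only [h2, h1, sub_eq_zero]
  exact F.gramMat_comm A (.inr a) (.inl i)

lemma reForm_schurVec (A : Rn n →L[ℝ] Rn n) (hA : IsUnit ((F.gramMat A).toBlocks₁₁).det)
    (a c : Fin k ⊕ Fin k) : reForm n (F.schurVec A a) (F.schurVec A c) = F.schur A a c := by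
  conv_lhs => arg 2; rw [schurVec]
  rw [map_sub, map_sum]
  simp only [map_smul, F.reForm_schurVec_w A hA, smul_zero, Finset.sum_const_zero, sub_zero]
  rw [schurVec, map_sub, LinearMap.sub_apply, map_sum, LinearMap.sum_apply, schur, Matrix.sub_apply]
  congr 1
  have h1 : (F.gramMat A).toBlocks₁₂ᵀ * (F.gramMat A).toBlocks₁₁⁻¹ =
      ((F.gramMat A).toBlocks₁₁⁻¹ * (F.gramMat A).toBlocks₁₂)ᵀ := by
    have h2 : (F.gramMat A).toBlocks₁₁ᵀ = (F.gramMat A).toBlocks₁₁ := F.isHermitian_block A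
    rw [Matrix.transpose_mul, Matrix.transpose_nonsing_inv, h2]
  rw [h1, Matrix.mul_apply]
  exact Finset.sum_congr rfl fun i _ => by
    rw [map_smul, LinearMap.smul_apply]; rfl

lemma inner_e_schurVec (A : Rn n →L[ℝ] Rn n) (j : Fin k) (a : Fin k ⊕ Fin k) :
    inner ℂ (F.e j) (F.schurVec A a) = inner ℂ (F.e j) (F.vec (.inr a)) := by
  rw [schurVec, inner_sub_right, F.inner_e_lift A j (F.vec_mem _), inner_sum]
  simp [inner_smul_ofReal, F.inner_e_lift A j (F.w_mem _), F.inner_ew]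

/-- The Schur complement is a Hermitian matrix. If `vⱼ` and `vⱼ'` are the basis vectors over `eⱼ`
and `i eⱼ` of the complement of the nondegenerate part of the graph, then the vectors `i vⱼ - vⱼ'`
lie in the conjugate of the radical, so that `b` vanishes on them. The real and imaginary parts of
these equations are the relations between the entries of a matrix in `ℋₖ`. -/
lemma schur_mem_HermMat (A : Skew n) (hA : IsUnit ((F.gramMat A).toBlocks₁₁).det) :
    (Matrix.of.symm (F.schur A)) ∈ HermMat k := by
  have hb : ∀ a c, bForm n (F.schurVec A a) (F.schurVec A c) = (F.schur A a c : ℝ) := fun a c => by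
    rw [(L.graph A).bForm_eq_reForm (F.schurVec_mem A a) (F.schurVec_mem A c),
      F.reForm_schurVec A hA]
  have hbw : ∀ a i, bForm n (F.schurVec A a) (L.lift A (F.w i)) = 0 := fun a i => by
    rw [(L.graph A).bForm_eq_reForm (F.schurVec_mem A a) (L.lift_mem A _),
      F.reForm_schurVec_w A hA, Complex.ofReal_zero]
  have hsymm : ∀ a c, F.schur A a c = F.schur A c a := fun a c => by
    have := hb a c
    rw [bForm_comm, hb] at this
    exact_mod_cast this.symm
  have key : ∀ j l, F.schur A (.inr j) (.inr l) = F.schur A (.inl j) (.inl l) ∧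
      F.schur A (.inl j) (.inr l) = -F.schur A (.inr j) (.inl l) := by
    intro j l
    have h1 : ∀ j m, inner ℂ (F.e m)
        (Complex.I • F.schurVec A (.inl j) - F.schurVec A (.inr j)) = 0 := fun j m => by
      rw [inner_sub_right, inner_smul_right, F.inner_e_schurVec, F.inner_e_schurVec]
      simp [vec]
    have h2 : ∀ j i, bForm n (Complex.I • F.schurVec A (.inl j) - F.schurVec A (.inr j))
        (L.lift A (F.w i)) = 0 := fun j i => by simp [hbw]
    have h3 := F.bForm_eq_zero_of_orthogonal A hA (h1 j) (h2 j) (h1 l) (h2 l)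
    simp only [map_sub, map_smul, LinearMap.sub_apply, LinearMap.smul_apply, hb, smul_eq_mul] at h3
    have h4 := congrArg Complex.re h3
    have h5 := congrArg Complex.im h3
    simp at h4 h5
    constructor <;> linarith
  rw [mem_HermMat]
  refine ⟨Matrix.of fun j l => ⟨F.schur A (.inl j) (.inl l), F.schur A (.inr j) (.inl l)⟩, ?_, ?_⟩
  · ext j l
    refine Complex.ext (hsymm _ _) ?_
    simp only [Matrix.conjTranspose_apply, Matrix.of_apply, RCLike.star_def, Complex.conj_im]
    rw [hsymm, (key j l).2, neg_neg]
  · ext a c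
    rcases a with a | a <;> rcases c with c | c
    · rfl
    · exact (key a c).2
    · rfl
    · exact (key a c).1

end Frame

/-! ### The translation action of Hermitian matrices -/

/-- The complex matrix represented by a real `2k × 2k` array, read off from its left half. -/
def complexify {k : ℕ} : (Fin k ⊕ Fin k → Fin k ⊕ Fin k → ℝ) →ₗ[ℝ] Matrix (Fin k) (Fin k) ℂ where
  toFun M := Matrix.of fun i j => ⟨M (.inl i) (.inl j), M (.inr i) (.inl j)⟩
  map_add' M M' := by ext i j; apply Complex.ext <;> simp
  map_smul' t M := by ext i j; apply Complex.ext <;> simp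

lemma complexify_apply {k : ℕ} (M : Fin k ⊕ Fin k → Fin k ⊕ Fin k → ℝ) (i j : Fin k) :
    complexify M i j = ⟨M (.inl i) (.inl j), M (.inr i) (.inl j)⟩ := rfl

lemma HermMat.entries {k : ℕ} (M : HermMat k) (i j : Fin k) :
    (starRingEnd ℂ) (complexify M.1 i j) = complexify M.1 j i ∧
      M.1 (.inl i) (.inr j) = -M.1 (.inr i) (.inl j) ∧
      M.1 (.inr i) (.inr j) = M.1 (.inl i) (.inl j) := by
  obtain ⟨h, hh, e⟩ := (mem_HermMat M.1).1 M.2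
  have e' : ∀ a c, M.1 a c = Matrix.fromBlocks (h.map Complex.re) (-h.map Complex.im)
    (h.map Complex.im) (h.map Complex.re) a c := fun a c => congrFun (congrFun e a) c
  have hc : ∀ i j, complexify M.1 i j = h i j := fun i j => by
    rw [complexify_apply, e', e']; rfl
  refine ⟨?_, ?_, ?_⟩
  · rw [hc, hc]
    exact congrFun (congrFun hh j) i
  · rw [e', e']; rfl
  · rw [e', e']; rfl

namespace Frame

variable {L : MaxIso n} {r s k : ℕ} (F : Frame L r s k)

/-- Half the value of a matrix on the component of a vector in the radical. -/
def radMap : (Fin k ⊕ Fin k → Fin k ⊕ Fin k → ℝ) →ₗ[ℝ] Cn n →ₗ[ℝ] Cn n :=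
  LinearMap.mk₂ ℝ (fun M z => ∑ j, ((1 / 2 : ℂ) * ∑ l, complexify M j l * inner ℂ (F.e l) z) • F.e j)
    (fun M M' z => by
      simp [map_add, add_mul, Finset.sum_add_distrib, mul_add, add_smul])
    (fun t M z => by
      simp only [map_smul, Matrix.smul_apply, Finset.smul_sum]
      refine Finset.sum_congr rfl fun j _ => ?_
      rw [← smul_assoc, ← mul_smul_comm, Finset.smul_sum]
      simp only [smul_mul_assoc])
    (fun M z z' => by
      simp [Finset.sum_add_distrib, mul_add, add_smul])
    (fun t M z => by
      simp only [inner_smul_ofReal, Finset.smul_sum]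
      refine Finset.sum_congr rfl fun j _ => ?_
      rw [← smul_assoc, ← mul_smul_comm, Finset.smul_sum]
      simp only [Complex.real_smul, mul_left_comm])

lemma radMap_apply (M : Fin k ⊕ Fin k → Fin k ⊕ Fin k → ℝ) (z : Cn n) :
    F.radMap M z = ∑ j, ((1 / 2 : ℂ) * ∑ l, complexify M j l * inner ℂ (F.e l) z) • F.e j := rfl

/-- The sesquilinear form of a Hermitian matrix, on the components of vectors in the radical. -/
def herm (M : HermMat k) (y z : Cn n) : ℂ :=
  ∑ j, ∑ l, (starRingEnd ℂ) (complexify M.1 j l * inner ℂ (F.e l) y) * inner ℂ (F.e j) z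

lemma conj_herm (M : HermMat k) (y z : Cn n) :
    (starRingEnd ℂ) (F.herm M y z) = F.herm M z y := by
  simp only [herm, map_sum, map_mul, (HermMat.entries M _ _).1]
  rw [Finset.sum_comm]
  refine Finset.sum_congr rfl fun j _ => Finset.sum_congr rfl fun l _ => ?_
  rw [Complex.conj_conj]
  ring

lemma inner_radMap (M : HermMat k) (y z : Cn n) :
    inner ℂ (F.radMap M.1 y) z = 1 / 2 * F.herm M y z := by
  rw [radMap_apply, sum_inner, herm, Finset.mul_sum]
  refine Finset.sum_congr rfl fun j _ => ?_
  rw [inner_smul_left, map_mul, map_sum, mul_assoc, Finset.sum_mul]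
  simp [Complex.conj_ofNat]

lemma I_smul_radMap_mem (M) (z : Cn n) : Complex.I • F.radMap M z ∈ L.V := by
  rw [radMap_apply, Finset.smul_sum]
  exact L.V.sum_mem fun j _ => by rw [smul_smul]; exact F.smul_e_mem _ _

lemma bForm_radMap (M M') (y z : Cn n) : bForm n (F.radMap M y) (F.radMap M' z) = 0 := by
  simp [radMap_apply, F.bForm_e _ (F.e_mem _)]

/-- The translation of the chart around `L` by a Hermitian matrix `M`: the skew map which moves the
point of a graph over `z` by the conjugate of `½ M z`, where `M` acts on the radical component of
`z`. It is skew because `M` is Hermitian, and the factor `½` makes `Re b` change by exactly `M`. -/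
def trans : HermMat k →ₗ[ℝ] Skew n where
  toFun M :=
    ⟨LinearMap.toContinuousLinearMap (L.coframe.toLinearMap ∘ₗ
        ((LinearMap.lsmul ℂ (Cn n) Complex.I).restrictScalars ℝ) ∘ₗ F.radMap M.1 ∘ₗ
          L.frame.toLinearMap), fun x y => by
      have key : ∀ x y, ⟪L.coframe (Complex.I • F.radMap M.1 (L.frame x)), y⟫_ℝ =
          (F.herm M (L.frame x) (L.frame y)).im / 2 := fun x y => by
        rw [L.coframe_inner, real_inner_eq_re, inner_smul_left, inner_radMap]
        simp; ring
      have key' : ⟪x, L.coframe (Complex.I • F.radMap M.1 (L.frame y))⟫_ℝ =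
          (F.herm M (L.frame y) (L.frame x)).im / 2 := (real_inner_comm _ _).trans (key y x)
      change ⟪L.coframe (Complex.I • F.radMap M.1 (L.frame x)), y⟫_ℝ =
        -⟪x, L.coframe (Complex.I • F.radMap M.1 (L.frame y))⟫_ℝ
      rw [key, key', ← F.conj_herm, Complex.conj_im]
      ring⟩
  map_add' M M' := by
    ext1; ext1 x
    change L.coframe (Complex.I • F.radMap (M.1 + M'.1) (L.frame x)) =
      L.coframe (Complex.I • F.radMap M.1 (L.frame x)) +
        L.coframe (Complex.I • F.radMap M'.1 (L.frame x))
    rw [map_add, LinearMap.add_apply, smul_add, map_add]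
  map_smul' t M := by
    ext1; ext1 x
    change L.coframe (Complex.I • F.radMap (t • M.1) (L.frame x)) =
      t • L.coframe (Complex.I • F.radMap M.1 (L.frame x))
    rw [LinearMap.map_smul, LinearMap.smul_apply, smul_comm, ContinuousLinearMap.map_smul]

lemma trans_apply (M : HermMat k) (x : Rn n) :
    (F.trans M : Rn n →L[ℝ] Rn n) x = L.coframe (Complex.I • F.radMap M.1 (L.frame x)) := rfl

lemma lift_add_trans (A : Rn n →L[ℝ] Rn n) (M : HermMat k) {z : Cn n} (hz : z ∈ L.V) :
    L.lift (A + F.trans M) z = L.lift A z + conjVec (F.radMap M.1 z) := by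
  rw [L.lift_eq _ hz, L.lift_eq _ hz, add_apply, map_add, map_add, trans_apply,
    L.frame_coframe hz, L.frame_coframe (F.I_smul_radMap_mem _ _), conjVec, add_assoc]

lemma herm_lift (M : HermMat k) (A : Rn n →L[ℝ] Rn n) {y z : Cn n} (hz : z ∈ L.V) :
    F.herm M y (L.lift A z) = F.herm M y z := by
  simp only [herm, F.inner_e_lift A _ hz]

/-- The change of `Re b` under a translation is exactly linear in `M`: the conjugate of the radical is
isotropic, and it is paired only with the radical components, which do not depend on `A`. -/
lemma reForm_lift_add_trans (A : Rn n →L[ℝ] Rn n) (M : HermMat k) {y z : Cn n} (hy : y ∈ L.V)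
    (hz : z ∈ L.V) :
    reForm n (L.lift (A + F.trans M) y) (L.lift (A + F.trans M) z) =
      reForm n (L.lift A y) (L.lift A z) + (F.herm M y z).re := by
  rw [F.lift_add_trans A M hy, F.lift_add_trans A M hz, reForm_apply, reForm_apply]
  simp only [map_add, LinearMap.add_apply, bForm_conjVec_conjVec, F.bForm_radMap, map_zero,
    add_zero]
  rw [bForm_conjVec, bForm_comm (conjVec _), bForm_conjVec, inner_radMap, inner_radMap,
    F.herm_lift M A hy, F.herm_lift M A hz, ← F.conj_herm M y z]
  simp
  ring

lemma herm_w (M : HermMat k) (i : Fin r ⊕ Fin s) (y : Cn n) : F.herm M y (F.w i) = 0 := by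
  simp [herm, F.inner_ew]

lemma herm_w' (M : HermMat k) (i : Fin r ⊕ Fin s) (y : Cn n) : F.herm M (F.w i) y = 0 := by
  simp [herm, F.inner_ew]

lemma re_herm_vec (M : HermMat k) (a c : Fin k ⊕ Fin k) :
    (F.herm M (F.vec (.inr a)) (F.vec (.inr c))).re = M.1 a c := by
  rcases a with a | a <;> rcases c with c | c <;>
  · simp only [herm, vec, Sum.elim_inl, Sum.elim_inr, inner_smul_right, F.inner_ee, mul_ite,
      mul_one, mul_zero, apply_ite (starRingEnd ℂ), map_zero, ite_mul, zero_mul, map_mul,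
      Complex.conj_I, (HermMat.entries M _ _).1]
    simp [complexify_apply, HermMat.entries M]

lemma toBlocks₁₁_add_trans (A : Rn n →L[ℝ] Rn n) (M : HermMat k) :
    (F.gramMat (A + F.trans M)).toBlocks₁₁ = (F.gramMat A).toBlocks₁₁ := by
  ext i j
  refine (F.reForm_lift_add_trans A M (F.vec_mem _) (F.vec_mem _)).trans ?_
  simp only [vec, Sum.elim_inl, F.herm_w, Complex.zero_re, add_zero]
  rfl

/-- The Schur complement is equivariant for the translations. -/
lemma schur_add_trans (A : Rn n →L[ℝ] Rn n) (M : HermMat k) :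
    F.schur (A + F.trans M) = F.schur A + Matrix.of M.1 := by
  have h1 := F.toBlocks₁₁_add_trans A M
  have h2 : (F.gramMat (A + F.trans M)).toBlocks₁₂ = (F.gramMat A).toBlocks₁₂ := by
    ext i j
    refine (F.reForm_lift_add_trans A M (F.vec_mem _) (F.vec_mem _)).trans ?_
    simp only [vec, Sum.elim_inl, F.herm_w', Complex.zero_re, add_zero]
    rfl
  have h3 : (F.gramMat (A + F.trans M)).toBlocks₂₂ = (F.gramMat A).toBlocks₂₂ + Matrix.of M.1 := by
    ext i j
    refine (F.reForm_lift_add_trans A M (F.vec_mem _) (F.vec_mem _)).trans ?_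
    rw [F.re_herm_vec]
    rfl
  rw [schur, schur, h1, h2, h3]
  abel

/-! ### Smoothness and the base point -/

lemma contDiff_gramMat (a c) : ContDiff ℝ ∞ fun A : Skew n => F.gramMat A a c := by
  have hc : ContDiff ℝ ∞ fun A : Skew n => (A : Rn n →L[ℝ] Rn n) :=
    ContinuousLinearMap.contDiff (𝕜 := ℝ) (E := Skew n) (F := Rn n →L[ℝ] Rn n) (Skew n).subtypeL
  have hl : ∀ z : Cn n, ContDiff ℝ ∞ fun A : Skew n => L.lift A z := fun z => by
    have : ∀ A : Skew n, L.lift A z = L.frame.toContinuousLinearMap (L.coframe z) +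
      conjFlip n (L.frame.toContinuousLinearMap ((A : Rn n →L[ℝ] Rn n) (L.coframe z))) :=
      fun A => L.graphMap_apply A _
    simp only [this]
    fun_prop
  have h : ∀ y z : Cn n, reForm n y z = ⟪conjFlip n (Complex.I • y), z⟫_ℝ := fun y z => by
    rw [← imForm_eq]
    simp [reForm_apply, imForm_apply']
  simp only [gramMat, Matrix.of_apply, h]
  exact ((conjFlip n).contDiff.comp ((hl _).const_smul Complex.I)).inner ℝ (hl _)

lemma gramMat_zero (a c) : F.gramMat 0 a c = (bForm n (F.vec a) (F.vec c)).re := by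
  rw [gramMat, Matrix.of_apply, L.lift_zero (F.vec_mem _), L.lift_zero (F.vec_mem _), reForm_apply]

lemma gramMat_zero_inl (i j : Fin r ⊕ Fin s) :
    F.gramMat 0 (.inl i) (.inl j) = if i = j then sgn r s i else 0 := by
  rw [gramMat_zero]
  simp only [vec, Sum.elim_inl, F.bForm_ww]
  split_ifs <;> simp

lemma gramMat_zero_inr (a) (j : Fin k ⊕ Fin k) : F.gramMat 0 a (.inr j) = 0 := by
  rw [gramMat_zero]
  have h : ∀ j, bForm n (F.vec a) (F.e j) = 0 := fun j => F.bForm_e' j (F.vec_mem a)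
  rcases j with j | j
  · simp only [vec, Sum.elim_inr, Sum.elim_inl] at h ⊢
    rw [h, Complex.zero_re]
  · simp only [vec, Sum.elim_inr] at h ⊢
    rw [map_smul, h, smul_zero, Complex.zero_re]

lemma schur_zero : F.schur 0 = 0 := by
  have h2 : (F.gramMat 0).toBlocks₁₂ = 0 := by ext i j; exact F.gramMat_zero_inr _ _
  have h3 : (F.gramMat 0).toBlocks₂₂ = 0 := by ext i j; exact F.gramMat_zero_inr _ _
  rw [schur, h2, h3]; simp

lemma nearSgn_zero : NearSgn r s (F.gramMat 0).toBlocks₁₁ := by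
  intro i j
  have : sgn r s i * (F.gramMat 0).toBlocks₁₁ i j - (1 : Matrix _ _ ℝ) i j = 0 := by
    change sgn r s i * F.gramMat 0 (.inl i) (.inl j) - _ = 0
    rw [F.gramMat_zero_inl, Matrix.one_apply]
    split_ifs <;> simp [sgn_mul_self]
  rw [this, abs_zero]
  positivity

/-- The neighbourhood of the base point in the chart on which the nondegenerate block of the Gram
matrix stays close to the standard form. It is invariant under the translations, since they do not
change this block. -/
def domain : Set (Skew n) := {A | NearSgn r s (F.gramMat A).toBlocks₁₁}

lemma isOpen_domain : IsOpen F.domain := by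
  have : F.domain = ⋂ i, ⋂ j, {A : Skew n | |sgn r s i * F.gramMat A (.inl i) (.inl j) -
      (1 : Matrix _ _ ℝ) i j| < (Fintype.card (Fin r ⊕ Fin s) + 1 : ℝ)⁻¹} := by
    ext A; simp only [Set.mem_iInter]; rfl
  rw [this]
  refine isOpen_iInter_of_finite fun i => isOpen_iInter_of_finite fun j => ?_
  have := (F.contDiff_gramMat (.inl i) (.inl j)).continuous
  exact isOpen_lt (by fun_prop) continuous_const

lemma add_trans_mem_domain {A : Skew n} (hA : A ∈ F.domain) (M : HermMat k) :
    A + F.trans M ∈ F.domain := by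
  change NearSgn r s (F.gramMat ((A : Rn n →L[ℝ] Rn n) + F.trans M)).toBlocks₁₁
  rw [F.toBlocks₁₁_add_trans]
  exact hA

end Frame

lemma contDiffAt_det {E ι : Type*} [NormedAddCommGroup E] [NormedSpace ℝ E] [Fintype ι]
    [DecidableEq ι] {M : E → Matrix ι ι ℝ} {x : E}
    (h : ∀ i j, ContDiffAt ℝ ∞ (fun y => M y i j) x) : ContDiffAt ℝ ∞ (fun y => (M y).det) x := by
  simp only [Matrix.det_apply]
  refine ContDiffAt.sum fun σ _ => ?_
  exact (contDiffAt_prod fun i _ => h _ _).const_smul _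

lemma contDiffAt_matrix_inv {E ι : Type*} [NormedAddCommGroup E] [NormedSpace ℝ E] [Fintype ι]
    [DecidableEq ι] {M : E → Matrix ι ι ℝ} {x : E}
    (h : ∀ i j, ContDiffAt ℝ ∞ (fun y => M y i j) x) (hx : (M x).det ≠ 0) (i j : ι) :
    ContDiffAt ℝ ∞ (fun y => (M y)⁻¹ i j) x := by
  simp only [Matrix.inv_def, Ring.inverse_eq_inv', Matrix.smul_apply, Matrix.adjugate_apply,
    smul_eq_mul]
  refine ((contDiffAt_det h).inv hx).mul (contDiffAt_det fun a c => ?_)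
  simp only [Matrix.updateRow_apply]
  split_ifs
  · exact contDiffAt_const
  · exact h a c

namespace Frame

variable {L : MaxIso n} {r s k : ℕ} (F : Frame L r s k)

lemma contDiffAt_schur {A : Skew n} (hA : A ∈ F.domain) (a c : Fin k ⊕ Fin k) :
    ContDiffAt ℝ ∞ (fun A : Skew n => F.schur A a c) A := by
  have hinv := contDiffAt_matrix_inv (M := fun A : Skew n => (F.gramMat A).toBlocks₁₁) (x := A)
    (fun i j => (F.contDiff_gramMat (.inl i) (.inl j)).contDiffAt) hA.isUnit_det.ne_zero
  have h12 : ∀ i j, ContDiffAt ℝ ∞ (fun A : Skew n => (F.gramMat A).toBlocks₁₂ i j) A :=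
    fun i j => (F.contDiff_gramMat (.inl i) (.inr j)).contDiffAt
  simp only [schur, Matrix.sub_apply, Matrix.mul_apply, Matrix.transpose_apply]
  refine (F.contDiff_gramMat (.inr a) (.inr c)).contDiffAt.sub ?_
  exact ContDiffAt.sum fun i _ => (ContDiffAt.sum fun j _ => (h12 j a).mul (hinv j i)).mul (h12 i c)

end Frame

/-! ### Existence of adapted frames -/

lemma reForm_comm (y z : Cn n) : reForm n y z = reForm n z y := by
  rw [reForm_apply, reForm_apply, bForm_comm]

lemma imForm_I_smul (y z : Cn n) : imForm n (Complex.I • y) z = reForm n y z := by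
  simp [reForm_apply, imForm_apply']

lemma reQuad_apply (W : Submodule ℝ (Cn n)) (y : W) : reQuad W y = reForm n y y := rfl

lemma two_mul_reForm (W : Submodule ℝ (Cn n)) (y z : W) :
    2 * reForm n y z = reQuad W (y + z) - reQuad W y - reQuad W z := by
  simp only [reQuad_apply, Submodule.coe_add, map_add, LinearMap.add_apply]
  rw [reForm_comm (z : Cn n) y]
  ring

namespace MaxIso

variable (L : MaxIso n)

/-- The largest complex subspace of `L`, which is also the radical of `Re b|_L`. -/
def cpart : Submodule ℂ (Cn n) where
  carrier := {z | z ∈ L.V ∧ Complex.I • z ∈ L.V}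
  add_mem' hy hz := ⟨L.V.add_mem hy.1 hz.1, by rw [smul_add]; exact L.V.add_mem hy.2 hz.2⟩
  zero_mem' := ⟨L.V.zero_mem, by simp⟩
  smul_mem' c z hz := by
    refine ⟨?_, ?_⟩
    · rw [smul_eq_re_add_im]
      exact L.V.add_mem (L.V.smul_mem _ hz.1) (L.V.smul_mem _ hz.2)
    · rw [smul_comm, smul_eq_re_add_im, smul_smul Complex.I Complex.I, Complex.I_mul_I, neg_one_smul]
      exact L.V.add_mem (L.V.smul_mem _ hz.2) (L.V.smul_mem _ (L.V.neg_mem hz.1))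

lemma bForm_cpart {y z : Cn n} (hy : y ∈ L.cpart) (hz : z ∈ L.V) : bForm n y z = 0 := by
  refine Complex.ext ?_ (L.bForm_im hy.1 hz)
  have := L.isotropic _ hy.2 _ hz
  rwa [imForm_I_smul] at this

lemma mem_cpart {z : Cn n} (hz : z ∈ L.V) (h : ∀ v ∈ L.V, reForm n z v = 0) : z ∈ L.cpart :=
  ⟨hz, L.mem_of_imForm fun v hv => by rw [imForm_I_smul, h v hv]⟩

/-- The orthogonal complement of the largest complex subspace in `L`. -/
def rpart : Submodule ℝ (Cn n) := L.V ⊓ (L.cpartᗮ).restrictScalars ℝ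

lemma exists_rpart {z : Cn n} (hz : z ∈ L.V) : ∃ y ∈ L.cpart, z - y ∈ L.rpart :=
  ⟨L.cpart.starProjection z, L.cpart.starProjection_apply_mem z,
    L.V.sub_mem hz (L.cpart.starProjection_apply_mem z).1,
    L.cpart.sub_starProjection_mem_orthogonal z⟩

lemma rpart_inf : L.rpart ⊓ L.cpart.restrictScalars ℝ = ⊥ := by
  rw [Submodule.eq_bot_iff]
  rintro z ⟨⟨-, h1⟩, h2⟩
  exact inner_self_eq_zero.1 (h1 z h2)

lemma rpart_sup : L.rpart ⊔ L.cpart.restrictScalars ℝ = L.V := by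
  refine le_antisymm (sup_le inf_le_left fun z hz => hz.1) fun z hz => ?_
  obtain ⟨y, hy, h⟩ := L.exists_rpart hz
  exact Submodule.mem_sup.2 ⟨_, h, y, hy, sub_add_cancel z y⟩

lemma finrank_rpart : Module.finrank ℝ L.rpart + 2 * Module.finrank ℂ L.cpart = n := by
  have h := Submodule.finrank_sup_add_finrank_inf_eq L.rpart (L.cpart.restrictScalars ℝ)
  rw [L.rpart_inf, L.rpart_sup, L.finrank_eq, finrank_bot, add_zero] at h
  have h2 : Module.finrank ℝ (L.cpart.restrictScalars ℝ) = 2 * Module.finrank ℂ L.cpart :=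
    finrank_real_of_complex L.cpart
  rw [h2] at h
  exact h.symm

lemma separatingLeft_rpart :
    LinearMap.SeparatingLeft (QuadraticMap.associated (R := ℝ) (reQuad L.rpart)) := by
  intro z hz
  have h0 : ∀ w : L.rpart, reForm n z w = 0 := fun w => by
    have h1 := hz w
    rw [QuadraticMap.associated_apply, ← two_mul_reForm] at h1
    simpa using h1
  have h1 : (z : Cn n) ∈ L.cpart := L.mem_cpart z.2.1 fun v hv => by
    obtain ⟨y, hy, h⟩ := L.exists_rpart hv
    have h2 := h0 ⟨_, h⟩
    have h3 : reForm n z y = 0 := by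
      rw [reForm_comm, reForm_apply, L.bForm_cpart hy z.2.1, Complex.zero_re]
    change reForm n z (v - y) = 0 at h2
    rwa [map_sub, h3, sub_zero] at h2
  exact Subtype.ext (inner_self_eq_zero.1 (z.2.2 z h1))

/-- The form is nondegenerate on the Hermitian complement of its radical, where it can be
diagonalized. -/
lemma exists_adapted_frame : ∃ r s k, Nonempty (Frame L r s k) := by
  classical
  obtain ⟨σ, hσ, ⟨f⟩⟩ := QuadraticForm.equivalent_one_neg_one_weighted_sum_squared
    (reQuad L.rpart) L.separatingLeft_rpart
  let u : Fin (Module.finrank ℝ L.rpart) → L.rpart := fun i => f.symm (Pi.single i 1)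
  have hQ : ∀ x, reQuad L.rpart (f.symm x) = ∑ i, σ i * (x i * x i) := fun x => by
    rw [f.symm.map_app, QuadraticMap.weightedSumSquares_apply]; rfl
  have hu : ∀ i j, reForm n (u i) (u j) = if i = j then σ i else 0 := by
    intro i j
    have h := two_mul_reForm L.rpart (u i) (u j)
    have hadd : u i + u j = f.symm (Pi.single i 1 + Pi.single j 1) := (map_add f.symm _ _).symm
    rw [hadd, hQ, hQ, hQ, ← Finset.sum_sub_distrib, ← Finset.sum_sub_distrib] at h
    have h2 : 2 * reForm n (u i) (u j) =
        ∑ l, 2 * σ l * ((Pi.single i 1 : Fin (Module.finrank ℝ L.rpart) → ℝ) l *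
          (Pi.single j 1 : Fin (Module.finrank ℝ L.rpart) → ℝ) l) := by
      rw [h]
      refine Finset.sum_congr rfl fun l _ => ?_
      simp only [Pi.add_apply]; ring
    simp only [Pi.single_apply, mul_ite, mul_one, mul_zero, Finset.sum_ite_eq', Finset.mem_univ,
      if_true] at h2
    split_ifs at h2 ⊢ with h3 h4 h4
    · subst h4; linarith
    · exact absurd h3.symm h4
    · exact absurd h4.symm h3
    · linarith
  let e := stdOrthonormalBasis ℂ L.cpart
  -- The positive vectors come first.
  let g : Fin (Module.finrank ℝ L.rpart) ≃
      Fin (Fintype.card {i // σ i = 1}) ⊕ Fin (Fintype.card {i // ¬ σ i = 1}) :=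
    (Equiv.sumCompl fun i => σ i = 1).symm.trans
      ((Fintype.equivFin _).sumCongr (Fintype.equivFin _))
  have hg : ∀ a, σ (g.symm a) = sgn _ _ a := by
    rintro (a | a)
    · exact ((Fintype.equivFin {i // σ i = 1}).symm a).2
    · exact (hσ _).resolve_right ((Fintype.equivFin {i // ¬ σ i = 1}).symm a).2
  have hmem : ∀ a, ((u a : L.rpart) : Cn n) ∈ L.V := fun a => (u a).2.1
  refine ⟨_, _, Module.finrank ℂ L.cpart, ⟨{
    w := fun a => u (g.symm a)
    e := fun j => (e j : Cn n)
    card := ?_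
    w_mem := fun a => hmem _
    e_mem := fun j => (e j).2.1
    I_smul_e_mem := fun j => (e j).2.2
    bForm_ww := fun a c => ?_
    inner_ee := fun i j => ?_
    inner_ew := fun j a => ?_ }⟩⟩
  · have h1 := Fintype.card_congr g
    rw [Fintype.card_sum, Fintype.card_fin, Fintype.card_fin, Fintype.card_fin] at h1
    rw [← h1]
    exact L.finrank_rpart.symm
  · rw [L.bForm_eq_reForm (hmem _) (hmem _), hu, hg]
    simp only [g.symm.injective.eq_iff]
    split_ifs <;> simp
  · have := orthonormal_iff_ite.1 e.orthonormal i j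
    rwa [Submodule.coe_inner] at this
  · exact (u (g.symm a)).2.2 (e j) (e j).2

end MaxIso

lemma hasSignature_zero_iff {p : Type*} [Fintype p] [DecidableEq p] {M : Matrix p p ℝ}
    (hM : M.IsHermitian) : HasSignature M.toQuadraticForm' 0 0 ↔ M = 0 := by
  constructor
  · intro h
    obtain ⟨w, e⟩ := M.toQuadraticForm'.equivalent_weightedSumSquares
    rw [hasSignature_iff_of_equivalent e] at h
    have hw := hasSignature_weightedSumSquares w
    have h1 := hw.1.symm.trans h.1
    have h2 := hw.2.symm.trans h.2
    rw [Set.ncard_eq_zero] at h1 h2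
    have hw0 : w = 0 := funext fun i => le_antisymm
      (not_lt.1 fun hi => (h1 ▸ hi : i ∈ (∅ : Set _)))
      (not_lt.1 fun hi => (h2 ▸ hi : i ∈ (∅ : Set _)))
    obtain ⟨f⟩ := e
    have hQ : ∀ v, v ⬝ᵥ M *ᵥ v = 0 := fun v => by
      rw [← toQuadraticForm'_apply, ← f.map_app, QuadraticMap.weightedSumSquares_apply]
      simp [hw0]
    have hd : ∀ i j, (Pi.single i 1 : p → ℝ) ⬝ᵥ M *ᵥ (Pi.single j 1) = M i j := by simp
    ext i j
    have h3 := hQ (Pi.single i 1 + Pi.single j 1)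
    rw [Matrix.mulVec_add, dotProduct_add, add_dotProduct, add_dotProduct, hQ, hQ, hd, hd] at h3
    have h4 : M j i = M i j := by simpa using hM.apply i j
    rw [Matrix.zero_apply]
    linarith
  · rintro rfl
    have h : (0 : Matrix p p ℝ).toQuadraticForm' = QuadraticMap.weightedSumSquares ℝ (0 : p → ℝ) := by
      ext v; simp [toQuadraticForm'_apply, QuadraticMap.weightedSumSquares_apply]
    rw [h]
    simpa using hasSignature_weightedSumSquares (0 : p → ℝ)

namespace Frame

variable {L : MaxIso n} {r s k : ℕ}

lemma hasSignature (F : Frame L r s k) : HasSignature (reQuad L.V) r s := by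
  have h := F.hasSignature_graph 0 (a := 0) (c := 0) F.nearSgn_zero
    ((hasSignature_zero_iff (by
      rw [ZeroMemClass.coe_zero, F.schur_zero]; exact Matrix.isHermitian_zero)).2 F.schur_zero)
  rwa [L.graph_zero] at h

end Frame

lemma exists_frame_of_hasSignature {L : MaxIso n} {r s : ℕ} (h : HasSignature (reQuad L.V) r s) :
    ∃ k, Nonempty (Frame L r s k) := by
  obtain ⟨r', s', k, ⟨F⟩⟩ := L.exists_adapted_frame
  have h' := F.hasSignature
  obtain rfl : r' = r := h'.1.symm.trans h.1
  obtain rfl : s' = s := h'.2.symm.trans h.2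
  exact ⟨k, ⟨F⟩⟩

/-! ### Slice charts of the orbit sets -/

/-- A linear splitting of a space along the image of an injective map. -/
lemma exists_split {E F : Type*} [NormedAddCommGroup E] [NormedSpace ℝ E] [FiniteDimensional ℝ E]
    [NormedAddCommGroup F] [NormedSpace ℝ F] [FiniteDimensional ℝ F] (τ : F →ₗ[ℝ] E)
    (hτ : Function.Injective τ) {m : ℕ} (hm : m = Module.finrank ℝ E - Module.finrank ℝ F) :
    ∃ Λ : E ≃L[ℝ] (EuclideanSpace ℝ (Fin m) × F), ∀ f, Λ (τ f) = (0, f) := by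
  obtain ⟨g, hg⟩ := LinearMap.exists_leftInverse_of_injective τ (LinearMap.ker_eq_bot.2 hτ)
  have hg' : ∀ f, g (τ f) = f := fun f => LinearMap.congr_fun hg f
  have hrange : LinearMap.range g = ⊤ := LinearMap.range_eq_top.2 fun f => ⟨τ f, hg' f⟩
  have hdim : Module.finrank ℝ (LinearMap.ker g) = Module.finrank ℝ (EuclideanSpace ℝ (Fin m)) := by
    have h1 := g.finrank_range_add_finrank_ker
    rw [hrange, finrank_top] at h1
    rw [finrank_euclideanSpace_fin]
    omega
  let Λ : E ≃ₗ[ℝ] (LinearMap.ker g × F) :=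
    { toFun := fun A => (⟨A - τ (g A), by simp [hg']⟩, g A)
      map_add' := fun A B => by ext1 <;> [ext1; skip] <;> simp; abel
      map_smul' := fun t A => by ext1 <;> [ext1; skip] <;> simp [smul_sub]
      invFun := fun x => x.1 + τ x.2
      left_inv := fun A => by simp
      right_inv := fun x => by
        have hx : g x.1 = 0 := x.1.2
        ext1 <;> [ext1; skip] <;> simp [hg', hx] }
  refine ⟨(Λ.trans ((LinearEquiv.ofFinrankEq _ _ hdim).prodCongr
    (LinearEquiv.refl ℝ F))).toContinuousLinearEquiv, fun f => ?_⟩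
  have h0 : Λ (τ f) = (0, f) := by
    ext1 <;> [ext1; skip] <;> simp [Λ, hg']
  simp [h0]

lemma MaxIso.continuous_graph (L : MaxIso n) : Continuous L.graph :=
  continuous_induced_rng.2 (L.contDiff_graphProj.continuous.congr fun A => (L.proj_graph A).symm)

/-- The graph charts do not leave the component of self-dual, respectively anti-self-dual,
subspaces, because their image is connected. -/
lemma graph_mem_IGr {ε : ℤˣ} (L : IGr n ε) (A : Skew n) : (L : MaxIso n).graph A ∈ IGr n ε := by
  have hclopen : IsClopen {A : Skew n | (L : MaxIso n).graph A ∈ IGr n ε} :=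
    ⟨(isClosed_hodgeEigen ε).preimage (L : MaxIso n).continuous_graph,
      (IGr n ε).isOpen.preimage (L : MaxIso n).continuous_graph⟩
  have h := hclopen.eq_univ ⟨0, by
    change (L : MaxIso n).graph 0 ∈ IGr n ε
    rw [(L : MaxIso n).graph_zero]; exact L.2⟩
  exact Set.eq_univ_iff_forall.1 h A

lemma mem_target_chartAt {ε : ℤˣ} (L : IGr n ε) (A : Skew n) : A ∈ (chartAt (Skew n) L).target := by
  rw [TopologicalSpace.Opens.chartAt_eq, OpenPartialHomeomorph.subtypeRestr_def,
    OpenPartialHomeomorph.trans_target]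
  refine ⟨trivial, ?_⟩
  rw [TopologicalSpace.Opens.openPartialHomeomorphSubtypeCoe_target]
  exact graph_mem_IGr L A

lemma graph_chartAt {ε : ℤˣ} {L K : IGr n ε} (hK : K ∈ (chartAt (Skew n) L).source) :
    (L : MaxIso n).graph (chartAt (Skew n) L K) = K := by
  have h : (K : MaxIso n) ∈ (L : MaxIso n).chart.source := by
    rw [TopologicalSpace.Opens.chartAt_eq] at hK
    exact (OpenPartialHomeomorph.subtypeRestr_source _ _).subset hK
  exact (L : MaxIso n).chart.left_inv h

lemma chartAt_self {ε : ℤˣ} (L : IGr n ε) : chartAt (Skew n) L L = 0 := by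
  have h := (L : MaxIso n).chart.right_inv (x := 0) trivial
  have h0 : (L : MaxIso n).chart.symm 0 = L := (L : MaxIso n).graph_zero
  rw [h0] at h
  exact h

lemma HermMat.isHermitian {k : ℕ} (M : HermMat k) : (Matrix.of M.1).IsHermitian := by
  have h := fun i j => Complex.ext_iff.1 (HermMat.entries M i j).1
  simp only [complexify_apply, Complex.conj_re, Complex.conj_im] at h
  ext a c
  rcases a with a | a <;> rcases c with c | c <;>
    simp only [Matrix.conjTranspose_apply, Matrix.of_apply, star_trivial]
  · exact (h c a).1
  · rw [(HermMat.entries M a c).2.1, ← (h a c).2]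
  · rw [(HermMat.entries M c a).2.1, (h c a).2]
  · rw [(HermMat.entries M c a).2.2, (HermMat.entries M a c).2.2, (h c a).1]

lemma exists_hermProj (k : ℕ) : ∃ π : (Fin k ⊕ Fin k → Fin k ⊕ Fin k → ℝ) →L[ℝ] HermMat k,
    ∀ M : HermMat k, π M = M :=
  Submodule.ClosedComplemented.of_finiteDimensional (HermMat k)

lemma exists_hasSignature {M : Type*} [AddCommGroup M] [Module ℝ M] (Q : QuadraticForm ℝ M) :
    HasSignature Q (sigPos Q) (sigNeg Q) := ⟨rfl, rfl⟩

/-- Around each of its points, an orbit set is the zero set of the Schur complement of the Gram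
matrix, which is equivariant for the translations by Hermitian matrices and records the signature
of nearby subspaces. -/
lemma exists_sliceChart {ε : ℤˣ} {r s k : ℕ} {L : IGr n ε} (F : Frame (L : MaxIso n) r s k) {m : ℕ}
    (hm : m = Module.finrank ℝ (Skew n) - Module.finrank ℝ (HermMat k)) :
    ∃ c : SliceChart (E := Skew n) (IGr n ε) (HermMat k) (orbitSet n ε r s) m,
      L ∈ c.chart.source ∧ ∀ y ∈ c.chart.source, ∀ a b,
        HermMat.HasSignature (c.H (c.chart y)) a b →
          HasSignature (reQuad (y : MaxIso n).V) (r + a) (s + b) := by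
  obtain ⟨π, hπ⟩ := exists_hermProj k
  let H : Skew n → HermMat k := fun A => π (Matrix.of.symm (F.schur A))
  have hH : ∀ A ∈ F.domain, Matrix.of (H A).1 = F.schur A := fun A hA => by
    have h := hπ ⟨_, F.schur_mem_HermMat A hA.isUnit_det⟩
    change Matrix.of (π (Matrix.of.symm (F.schur A))).1 = _
    rw [h]; rfl
  have hHadd : ∀ A ∈ F.domain, ∀ M, H (A + F.trans M) = H A + M := fun A hA M => by
    have h : Matrix.of (H (A + F.trans M)).1 = Matrix.of (H A + M).1 := by
      rw [hH _ (F.add_trans_mem_domain hA M), Submodule.coe_add A, F.schur_add_trans, ← hH A hA]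
      rfl
    exact Subtype.ext (Matrix.of.injective h)
  -- A nonzero translation changes `H`, so it is nonzero.
  have hinj : Function.Injective F.trans := fun M M' h => by
    have h1 := hHadd 0 F.nearSgn_zero M
    rw [h, hHadd 0 F.nearSgn_zero M'] at h1
    exact (add_left_cancel h1).symm
  obtain ⟨Λ, hΛ⟩ := exists_split (E := Skew n) (F := HermMat k) F.trans hinj hm
  -- The full graph chart has image `Skew n`, so its restriction has image `F.domain`.
  let chart : OpenPartialHomeomorph (IGr n ε) (Skew n) :=
    (chartAt (Skew n) L).trans (OpenPartialHomeomorph.ofSet F.domain F.isOpen_domain)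
  have htarget : chart.target = F.domain := by
    rw [OpenPartialHomeomorph.trans_target]
    exact Set.inter_eq_left.2 fun A _ => mem_target_chartAt L A
  have hmem : chart ∈ IsManifold.maximalAtlas 𝓘(ℝ, Skew n) ∞ (IGr n ε) := by
    have h0 := IsManifold.chart_mem_maximalAtlas (I := 𝓘(ℝ, Skew n)) (n := ∞) L
    refine OpenPartialHomeomorph.mem_maximalAtlas_of_contMDiffOn _ ?_ ?_
    · exact (contMDiffOn_of_mem_maximalAtlas h0).mono fun y hy => hy.1
    · exact (contMDiffOn_symm_of_mem_maximalAtlas h0).mono fun A _ => mem_target_chartAt L A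
  have hsig : ∀ y ∈ chart.source, ∀ a b, HermMat.HasSignature (H (chart y)) a b →
      HasSignature (reQuad (y : MaxIso n).V) (r + a) (s + b) := fun y hy a b h => by
    rw [HermMat.HasSignature, hH (chart y) hy.2] at h
    have := F.hasSignature_graph (chartAt (Skew n) L y) hy.2 h
    rw [graph_chartAt hy.1] at this
    exact this
  refine ⟨{
    chart := chart
    chart_mem := hmem
    τ := LinearMap.toContinuousLinearMap F.trans
    H := H
    contDiffOn_H := ?_
    add_mem := fun A hA M => by
      rw [htarget] at hA ⊢
      exact F.add_trans_mem_domain hA M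
    H_add := fun A hA M => hHadd A (htarget ▸ hA) M
    mem_iff := fun y hy => ?_
    split := Λ
    split_τ := hΛ }, ⟨mem_chart_source _ L, ?_⟩, hsig⟩
  · rw [htarget]
    intro A hA
    refine ContDiffAt.contDiffWithinAt (π.contDiff.contDiffAt.comp A ?_)
    exact contDiffAt_pi.2 fun a => contDiffAt_pi.2 fun c => F.contDiffAt_schur hA a c
  · have h := hsig y hy _ _ (exists_hasSignature _)
    have hherm := HermMat.isHermitian (H (chart y))
    constructor
    · intro hy'
      have h1 := h.1.symm.trans hy'.1
      have h2 := h.2.symm.trans hy'.2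
      have h3 := (hasSignature_zero_iff hherm).1 ⟨by omega, by omega⟩
      exact Subtype.ext h3
    · intro h0
      have h1 : HermMat.HasSignature (H (chart y)) 0 0 := (hasSignature_zero_iff hherm).2 (by
        rw [h0]; rfl)
      exact hsig y hy 0 0 h1
  · change (chartAt (Skew n) L L) ∈ F.domain
    rw [chartAt_self]
    exact F.nearSgn_zero

/-! ### Invariance under the special orthogonal group -/

lemma smul_V (g : SO n) (L : MaxIso n) : (g • L).V = L.V.map (actMap g) := rfl

lemma SO.mul_transpose (g : SO n) :
    (g : Matrix (Fin n) (Fin n) ℂ) * (g : Matrix (Fin n) (Fin n) ℂ)ᵀ = 1 :=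
  (Matrix.mem_orthogonalGroup_iff (Fin n) ℂ).1 g.2.1

lemma smul_eq_of_mem (g : SO n) {L K : MaxIso n} (h : ∀ z ∈ L.V, actMap g z ∈ K.V) : g • L = K := by
  refine MaxIso.eq_of_le ?_
  rw [smul_V]
  rintro _ ⟨z, hz, rfl⟩
  exact h z hz

/-- The real coordinates on `ℂⁿ` with respect to `e₁, …, eₙ, i e₁, …, i eₙ`. -/
def realCoord (n : ℕ) : Cn n ≃ₗ[ℝ] (Fin n ⊕ Fin n → ℝ) where
  toFun z := Sum.elim (fun i => (z i).re) (fun i => (z i).im)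
  map_add' y z := by ext a; rcases a with a | a <;> simp
  map_smul' t z := by ext a; rcases a with a | a <;> simp
  invFun x := WithLp.toLp 2 fun i => ⟨x (.inl i), x (.inr i)⟩
  left_inv z := by ext i; rfl
  right_inv x := by ext a; rcases a with a | a <;> rfl

lemma vol_eq_det (w : Fin n ⊕ Fin n → Cn n) :
    vol w = (Module.Basis.ofEquivFun (realCoord n)).det w := by
  rw [vol, Module.Basis.det_apply, ← Matrix.det_transpose]
  congr 1

lemma det_actMap (g : Matrix (Fin n) (Fin n) ℂ) :
    LinearMap.det (actMap g) = Complex.normSq g.det := by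
  rw [actMap, LinearMap.det_restrictScalars, Algebra.norm_complex_apply,
    Matrix.toEuclideanLin_eq_toLin_orthonormal, LinearMap.det_toLin]

lemma vol_actMap (g : SO n) (w : Fin n ⊕ Fin n → Cn n) : vol (actMap g ∘ w) = vol w := by
  have h : (g : Matrix (Fin n) (Fin n) ℂ).det = 1 := g.2.2
  rw [vol_eq_det, vol_eq_det, Module.Basis.det_comp, det_actMap, h, map_one, one_mul]

/-- Complex orthogonal transformations of determinant `1` preserve the real orientation and the
inner product, hence commute with the Hodge star. -/
lemma hodgeEigen_smul (g : SO n) {ε : ℤˣ} {L : MaxIso n} (h : HodgeEigen ε L.V) :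
    HodgeEigen ε (g • L).V := by
  intro u v hv
  choose v' hv' hvv' using hv
  have hu : ∀ i, actMap g (actMap (g : Matrix (Fin n) (Fin n) ℂ)ᵀ (u i)) = u i := fun i => by
    rw [← LinearMap.comp_apply, ← actMap_mul, SO.mul_transpose, actMap_one]; rfl
  have h1 := h (fun i => actMap (g : Matrix (Fin n) (Fin n) ℂ)ᵀ (u i)) v' hv'
  rw [← vol_actMap g] at h1
  have h2 : actMap g ∘ (Sum.elim (fun i => actMap (g : Matrix (Fin n) (Fin n) ℂ)ᵀ (u i)) v') =
      Sum.elim u v := by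
    funext a
    rcases a with i | i
    · exact hu i
    · exact hvv' i
  rw [h2] at h1
  rw [h1]
  congr 1
  ext i j
  rw [gram, gram, Matrix.of_apply, Matrix.of_apply, imForm_apply', imForm_apply',
    ← bForm_actMap g, hu, hvv']

lemma hasSignature_smul (g : SO n) {L : MaxIso n} {r s : ℕ} (h : HasSignature (reQuad L.V) r s) :
    HasSignature (reQuad (g • L).V) r s := by
  have hinj : Function.Injective (actMap (g : Matrix (Fin n) (Fin n) ℂ)) :=
    Function.LeftInverse.injective (g := actMap (g : Matrix (Fin n) (Fin n) ℂ)ᵀ) fun z => by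
      rw [← LinearMap.comp_apply, ← actMap_mul, SO.transpose_mul, actMap_one]; rfl
  refine (hasSignature_iff_of_equivalent ⟨⟨Submodule.equivMapOfInjective _ hinj L.V, fun z => ?_⟩⟩
    r s).1 h
  change reForm n (actMap g z) (actMap g z) = reForm n z z
  rw [reForm_apply, bForm_actMap, reForm_apply]

/-! ### Orbits -/

lemma actMap_col {ι : Type*} (v : ι → Cn n) (g : Matrix (Fin n) (Fin n) ℂ) (a : ι) (i : Fin n) :
    actMap g (v a) i = (g * Matrix.of fun i a => v a i) i a := rfl

lemma actMap_smul (g : Matrix (Fin n) (Fin n) ℂ) (c : ℂ) (z : Cn n) :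
    actMap g (c • z) = c • actMap g z :=
  map_smul (Matrix.toEuclideanLin g) c z

namespace Frame

variable {L L' : MaxIso n} {r s k : ℕ}

lemma span_vec (F : Frame L r s k) : Submodule.span ℝ (Set.range F.vec) = L.V := by
  refine Submodule.eq_of_le_of_finrank_eq (Submodule.span_le.2 (Set.range_subset_iff.2 F.vec_mem)) ?_
  rw [finrank_span_eq_card F.linearIndependent_vec, L.finrank_eq, F.card_index]

lemma mem_of_forall_vec (F : Frame L r s k) {W : Submodule ℝ (Cn n)} (h : ∀ a, F.vec a ∈ W) :
    L.V ≤ W := by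
  rw [← F.span_vec]
  exact Submodule.span_le.2 (Set.range_subset_iff.2 h)

/-- The complex basis of `ℂⁿ` obtained by adding to a frame the conjugates of the radical. -/
def cvec (F : Frame L r s k) : (Fin r ⊕ Fin s) ⊕ (Fin k ⊕ Fin k) → Cn n :=
  Sum.elim F.w (Sum.elim F.e fun j => conjVec (F.e j))

/-- The matrix with columns `F.cvec`. -/
def mat (F : Frame L r s k) : Matrix (Fin n) ((Fin r ⊕ Fin s) ⊕ (Fin k ⊕ Fin k)) ℂ :=
  Matrix.of fun i a => F.cvec a i

/-- The Gram matrix of the standard complex basis: orthonormal vectors and a hyperbolic part. -/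
def stdGram (r s k : ℕ) :
    Matrix ((Fin r ⊕ Fin s) ⊕ (Fin k ⊕ Fin k)) ((Fin r ⊕ Fin s) ⊕ (Fin k ⊕ Fin k)) ℂ :=
  Matrix.fromBlocks (Matrix.diagonal fun i => (sgn r s i : ℂ)) 0 0 (Matrix.fromBlocks 0 1 1 0)

lemma stdGram_mul_self : stdGram r s k * stdGram r s k = 1 := by
  have h : ∀ i, (sgn r s i : ℂ) * sgn r s i = 1 := fun i => by exact_mod_cast sgn_mul_self i
  simp [stdGram, Matrix.fromBlocks_multiply, h]

lemma stdGram_transpose : (stdGram r s k)ᵀ = stdGram r s k := by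
  simp [stdGram, Matrix.fromBlocks_transpose]

lemma mat_transpose_mul (F : Frame L r s k) : F.matᵀ * F.mat = stdGram r s k := by
  have h : ∀ a c, (F.matᵀ * F.mat) a c = bForm n (F.cvec a) (F.cvec c) := fun a c => rfl
  have hwc : ∀ i j, bForm n (F.w i) (conjVec (F.e j)) = 0 := fun i j => by
    rw [bForm_conjVec, F.inner_ew]
  have hec : ∀ i j, bForm n (F.e i) (conjVec (F.e j)) = if i = j then 1 else 0 := fun i j => by
    rw [bForm_conjVec, F.inner_ee]; simp only [eq_comm]
  ext a c
  rw [h]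
  rcases a with i | i | i <;> rcases c with j | j | j <;>
    simp only [cvec, stdGram, Sum.elim_inl, Sum.elim_inr, Matrix.fromBlocks_apply₁₁,
      Matrix.fromBlocks_apply₁₂, Matrix.fromBlocks_apply₂₁, Matrix.fromBlocks_apply₂₂,
      Matrix.zero_apply, Matrix.one_apply, Matrix.diagonal_apply]
  · exact F.bForm_ww i j
  · exact F.bForm_e' j (F.w_mem i)
  · exact hwc i j
  · exact F.bForm_e i (F.w_mem j)
  · exact F.bForm_e i (F.e_mem j)
  · exact hec i j
  · rw [bForm_comm, hwc]
  · rw [bForm_comm, hec]; simp only [eq_comm]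
  · rw [bForm_conjVec_conjVec, F.bForm_e i (F.e_mem j), map_zero]

/-- The inverse of the matrix of a frame. -/
def matInv (F : Frame L r s k) : Matrix ((Fin r ⊕ Fin s) ⊕ (Fin k ⊕ Fin k)) (Fin n) ℂ :=
  stdGram r s k * F.matᵀ

lemma matInv_mul (F : Frame L r s k) : F.matInv * F.mat = 1 := by
  rw [matInv, Matrix.mul_assoc, F.mat_transpose_mul, stdGram_mul_self]

lemma mul_matInv (F : Frame L r s k) : F.mat * F.matInv = 1 :=
  (Matrix.mul_eq_one_comm_of_card_eq _ _ ℂ (by rw [F.card_index, Fintype.card_fin])).1 F.matInv_mul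

/-- A change of sign of the `w`-vectors. -/
def signs (k : ℕ) (σ : Fin r ⊕ Fin s → ℂ) : (Fin r ⊕ Fin s) ⊕ (Fin k ⊕ Fin k) → ℂ :=
  Sum.elim σ 1

/-- The matrix mapping one frame to another one, up to signs. -/
def transfer (F : Frame L r s k) (F' : Frame L' r s k) (σ : Fin r ⊕ Fin s → ℂ) :
    Matrix (Fin n) (Fin n) ℂ :=
  F'.mat * Matrix.diagonal (signs k σ) * F.matInv

lemma signs_comm (σ : Fin r ⊕ Fin s → ℂ) :
    Matrix.diagonal (signs k σ) * stdGram r s k = stdGram r s k * Matrix.diagonal (signs k σ) := by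
  have : Matrix.diagonal (signs k σ) = Matrix.fromBlocks (Matrix.diagonal σ) 0 0 1 := by
    rw [signs, ← Matrix.diagonal_one, Matrix.fromBlocks_diagonal]
    rfl
  rw [this, stdGram, Matrix.fromBlocks_multiply, Matrix.fromBlocks_multiply]
  simp [mul_comm]

lemma transfer_orthogonal (F : Frame L r s k) (F' : Frame L' r s k) {σ : Fin r ⊕ Fin s → ℂ}
    (hσ : ∀ i, σ i * σ i = 1) : (transfer F F' σ)ᵀ * transfer F F' σ = 1 := by
  set S := Matrix.diagonal (signs k σ) with hS
  have h1 : S * S = 1 := by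
    rw [hS, Matrix.diagonal_mul_diagonal, ← Matrix.diagonal_one]
    congr 1
    funext a
    rcases a with a | a
    · exact hσ a
    · exact one_mul 1
  have h2 : Sᵀ = S := Matrix.diagonal_transpose _
  have h3 : F.matInvᵀ = F.mat * stdGram r s k := by
    rw [matInv, Matrix.transpose_mul, Matrix.transpose_transpose, stdGram_transpose]
  calc (transfer F F' σ)ᵀ * transfer F F' σ
      = F.matInvᵀ * (S * (F'.matᵀ * F'.mat) * S) * F.matInv := by
        rw [transfer, Matrix.transpose_mul, Matrix.transpose_mul, ← hS, h2]
        simp only [Matrix.mul_assoc]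
    _ = F.mat * (stdGram r s k * stdGram r s k) * F.matInv := by
        rw [F'.mat_transpose_mul, hS, signs_comm, ← hS, Matrix.mul_assoc _ S S, h1, Matrix.mul_one,
          h3]
        simp only [Matrix.mul_assoc]
    _ = 1 := by rw [stdGram_mul_self, Matrix.mul_one, F.mul_matInv]

lemma det_transfer (F : Frame L r s k) (F' : Frame L' r s k) (σ : Fin r ⊕ Fin s → ℂ) :
    (transfer F F' σ).det = (∏ i, σ i) * (transfer F F' 1).det := by
  have h1 : transfer F F' σ =
      (F'.mat * Matrix.diagonal (signs k σ) * F'.matInv) * transfer F F' 1 := by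
    have h2 : Matrix.diagonal (signs (r := r) (s := s) k 1) = 1 := by
      rw [← Matrix.diagonal_one]
      congr 1
      funext a
      rcases a with a | a <;> rfl
    rw [transfer, transfer, h2, Matrix.mul_one, Matrix.mul_assoc (F'.mat * _) F'.matInv,
      ← Matrix.mul_assoc F'.matInv, F'.matInv_mul, Matrix.one_mul]
  rw [h1, Matrix.det_mul, Matrix.det_conj_of_mul_eq_one F'.mul_matInv F'.matInv_mul,
    Matrix.det_diagonal]
  simp [signs]

lemma transfer_cvec (F : Frame L r s k) (F' : Frame L' r s k) (σ : Fin r ⊕ Fin s → ℂ) (a) :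
    actMap (transfer F F' σ) (F.cvec a) = signs k σ a • F'.cvec a := by
  ext i
  rw [actMap_col]
  change (transfer F F' σ * F.mat) i a = _
  rw [transfer, Matrix.mul_assoc, F.matInv_mul, Matrix.mul_one, Matrix.mul_diagonal, mul_comm]
  rfl

lemma transfer_mem (F : Frame L r s k) (F' : Frame L' r s k) {σ : Fin r ⊕ Fin s → ℂ}
    (hσ : ∀ i, σ i = 1 ∨ σ i = -1) {z : Cn n} (hz : z ∈ L.V) :
    actMap (transfer F F' σ) z ∈ L'.V := by
  refine F.mem_of_forall_vec (W := L'.V.comap (actMap (transfer F F' σ))) (fun a => ?_) hz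
  rw [Submodule.mem_comap]
  have he : ∀ j, actMap (transfer F F' σ) (F.e j) = F'.e j := fun j =>
    (F.transfer_cvec F' σ (.inr (.inl j))).trans (one_smul ℂ _)
  rcases a with i | j | j
  · have h : actMap (transfer F F' σ) (F.w i) = σ i • F'.w i := F.transfer_cvec F' σ (.inl i)
    change actMap (transfer F F' σ) (F.w i) ∈ L'.V
    rw [h]
    rcases hσ i with h1 | h1 <;> rw [h1]
    · rw [one_smul]; exact F'.w_mem i
    · rw [neg_one_smul]; exact L'.V.neg_mem (F'.w_mem i)
  · change actMap (transfer F F' σ) (F.e j) ∈ L'.V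
    rw [he]; exact F'.e_mem j
  · change actMap (transfer F F' σ) (Complex.I • F.e j) ∈ L'.V
    rw [actMap_smul, he]; exact F'.I_smul_e_mem j

/-- Witt's theorem for adapted frames. If the form on `L` does not vanish, a change of sign of one
frame vector corrects the determinant. -/
lemma mem_orbit (F : Frame L r s k) (F' : Frame L' r s k) (h : 0 < r + s) :
    L' ∈ MulAction.orbit (SO n) L := by
  have hdet : (transfer F F' 1).det = 1 ∨ (transfer F F' 1).det = -1 := by
    have := congrArg Matrix.det (F.transfer_orthogonal F' (σ := 1) (by simp))
    rw [Matrix.det_mul, Matrix.det_transpose, Matrix.det_one] at this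
    exact mul_self_eq_one_iff.1 this
  obtain ⟨σ, hσ, hσd⟩ : ∃ σ : Fin r ⊕ Fin s → ℂ, (∀ i, σ i = 1 ∨ σ i = -1) ∧
      (transfer F F' σ).det = 1 := by
    rcases hdet with hd | hd
    · exact ⟨1, fun i => Or.inl rfl, hd⟩
    · have : Nonempty (Fin r ⊕ Fin s) := Fintype.card_pos_iff.1 (by simpa using h)
      let i₀ := Classical.arbitrary (Fin r ⊕ Fin s)
      refine ⟨Function.update 1 i₀ (-1), fun i => ?_, ?_⟩
      · rcases eq_or_ne i i₀ with rfl | hi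
        · right; simp
        · left; simp [hi]
      · rw [det_transfer, hd, Finset.prod_update_of_mem (Finset.mem_univ _)]
        simp
  refine ⟨⟨transfer F F' σ, (Matrix.mem_orthogonalGroup_iff' (Fin n) ℂ).2
    (F.transfer_orthogonal F' fun i => ?_), hσd⟩, smul_eq_of_mem _ fun z hz => F.transfer_mem F' hσ hz⟩
  rcases hσ i with h1 | h1 <;> simp [h1]

end Frame

/-! ### Complex maximal isotropic subspaces -/

namespace Frame

variable {L : MaxIso n} {k : ℕ}

lemma I_smul_mem (F : Frame L 0 0 k) {z : Cn n} (hz : z ∈ L.V) : Complex.I • z ∈ L.V := by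
  have h : L.V ≤ L.cpart.restrictScalars ℝ := by
    refine F.mem_of_forall_vec ?_
    rintro ((i | i) | j | j)
    · exact i.elim0
    · exact i.elim0
    · exact ⟨F.e_mem j, F.I_smul_e_mem j⟩
    · exact ⟨F.I_smul_e_mem j, by
        simpa [vec, ← mul_smul, Complex.I_mul_I] using L.V.neg_mem (F.e_mem j)⟩
  exact (h hz).2

lemma bForm_eq_zero (F : Frame L 0 0 k) {y z : Cn n} (hy : y ∈ L.V) (hz : z ∈ L.V) :
    bForm n y z = 0 :=
  L.bForm_cpart ⟨hy, F.I_smul_mem hy⟩ hz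

/-- The conjugates of the frame vectors span `conjFlip L` over `ℂ`. -/
lemma exists_conjFlip_eq (F : Frame L 0 0 k) {z : Cn n} (hz : z ∈ L.V) :
    ∃ a : Fin k → ℂ, conjFlip n z = ∑ m, a m • conjVec (F.e m) := by
  rw [← F.span_vec] at hz
  induction hz using Submodule.span_induction with
  | mem z h =>
    obtain ⟨(i | i) | j | j, rfl⟩ := h
    · exact i.elim0
    · exact i.elim0
    · refine ⟨Pi.single j Complex.I, ?_⟩
      rw [Finset.sum_eq_single j (fun m _ hm => by rw [Pi.single_eq_of_ne hm, zero_smul])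
        (fun h => absurd (Finset.mem_univ j) h), Pi.single_eq_same]
      ext i
      rw [PiLp.smul_apply, conjVec_apply, conjFlip_apply]
      rfl
    · refine ⟨Pi.single j 1, ?_⟩
      rw [Finset.sum_eq_single j (fun m _ hm => by rw [Pi.single_eq_of_ne hm, zero_smul])
        (fun h => absurd (Finset.mem_univ j) h), Pi.single_eq_same, one_smul]
      rfl
  | zero => exact ⟨0, by simp⟩
  | add y z _ _ hy hz =>
    obtain ⟨a, ha⟩ := hy
    obtain ⟨c, hc⟩ := hz
    exact ⟨a + c, by simp [ha, hc, add_smul, Finset.sum_add_distrib]⟩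
  | smul t z _ hz =>
    obtain ⟨a, ha⟩ := hz
    exact ⟨fun m => t * a m, by simp [ha, Finset.smul_sum, mul_smul]⟩

/-- If `b` vanishes on `L` and on the graph of `A` over `L`, then the graph is the image of `L` under
a unipotent complex orthogonal transformation. So nearby points lie in one orbit of the special
orthogonal group, although Witt's theorem only provides an orthogonal transformation. -/
lemma graph_mem_orbit (F : Frame L 0 0 k) {A : Skew n} {k' : ℕ} (F' : Frame (L.graph A) 0 0 k') :
    L.graph A ∈ MulAction.orbit (SO n) L := by
  -- The graph has the basis vectors `dⱼ = eⱼ + ∑ₘ aⱼₘ ēₘ`, and `b(dᵢ, dⱼ) = aᵢⱼ + aⱼᵢ`.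
  choose a ha using fun j => F.exists_conjFlip_eq
    (L.frame_mem ((A : Rn n →L[ℝ] Rn n) (L.coframe (F.e j))))
  have hd : ∀ j, L.lift A (F.e j) = F.e j + ∑ m, a j m • conjVec (F.e m) := fun j => by
    rw [L.lift_eq _ (F.e_mem j), ha]
  have hfe : ∀ i j, bForm n (conjVec (F.e i)) (F.e j) = if i = j then 1 else 0 := fun i j => by
    rw [bForm_comm, bForm_conjVec, F.inner_ee]
  have hff : ∀ i j, bForm n (conjVec (F.e i)) (conjVec (F.e j)) = 0 := fun i j => by
    rw [bForm_conjVec_conjVec, F.bForm_e i (F.e_mem j), map_zero]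
  let α : Matrix (Fin k) (Fin k) ℂ := Matrix.of a
  have hα : α + αᵀ = 0 := by
    ext i j
    have h := F'.bForm_eq_zero (L.lift_mem A (F.e i)) (L.lift_mem A (F.e j))
    rw [hd, hd] at h
    simp only [map_add, map_sum, map_smul, LinearMap.add_apply, LinearMap.sum_apply,
      LinearMap.smul_apply, hff, hfe, bForm_comm (F.e i) (conjVec _), F.bForm_e i (F.e_mem j),
      smul_eq_mul, mul_zero, mul_ite, mul_one, Finset.sum_const_zero, Finset.sum_ite_eq',
      Finset.mem_univ, if_true, add_zero, zero_add] at h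
    simpa [α, add_comm] using h
  let f : Matrix (Fin n) (Fin k) ℂ := Matrix.of fun i j => conjVec (F.e j) i
  let e : Matrix (Fin n) (Fin k) ℂ := Matrix.of fun i j => F.e j i
  have hf : fᵀ * f = 0 := by ext i j; exact hff i j
  have he : fᵀ * e = 1 := by ext i j; rw [Matrix.one_apply]; exact hfe i j
  -- `g` fixes the conjugates `ēⱼ` and maps `eⱼ` to `dⱼ`.
  let g : Matrix (Fin n) (Fin n) ℂ := 1 + f * (αᵀ * fᵀ)
  have hg : gᵀ * g = 1 := by
    have h1 : gᵀ = 1 + f * (α * fᵀ) := by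
      simp only [g, Matrix.transpose_add, Matrix.transpose_one, Matrix.transpose_mul,
        Matrix.transpose_transpose, Matrix.mul_assoc]
    have h2 : f * (α * fᵀ) * (f * (αᵀ * fᵀ)) = 0 := by
      rw [Matrix.mul_assoc f, Matrix.mul_assoc α, ← Matrix.mul_assoc fᵀ, hf, Matrix.zero_mul,
        Matrix.mul_zero, Matrix.mul_zero]
    have h3 : f * (αᵀ * fᵀ) + f * (α * fᵀ) = 0 := by
      rw [← Matrix.mul_add, ← Matrix.add_mul, add_comm αᵀ, hα, Matrix.zero_mul, Matrix.mul_zero]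
    rw [h1, Matrix.add_mul, Matrix.one_mul, Matrix.mul_add, h2, Matrix.mul_one, add_zero, add_assoc,
      h3, add_zero]
  have hdet : g.det = 1 := by
    rw [Matrix.det_one_add_mul_comm, Matrix.mul_assoc, hf, Matrix.mul_zero, add_zero,
      Matrix.det_one]
  have hge : ∀ j, actMap g (F.e j) = L.lift A (F.e j) := fun j => by
    have h : g * e = e + f * αᵀ := by
      rw [Matrix.add_mul, Matrix.one_mul, Matrix.mul_assoc, Matrix.mul_assoc, he, Matrix.mul_one]
    ext i
    rw [actMap_col]
    change (g * e) i j = _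
    rw [h, hd, Matrix.add_apply, PiLp.add_apply, Matrix.mul_apply, WithLp.ofLp_sum,
      Finset.sum_apply]
    refine congrArg₂ _ rfl (Finset.sum_congr rfl fun m _ => ?_)
    rw [PiLp.smul_apply, smul_eq_mul, mul_comm]
    rfl
  have hmem : ∀ j, actMap g (F.e j) ∈ (L.graph A).V := fun j => by
    rw [hge]; exact L.lift_mem A _
  refine ⟨⟨g, (Matrix.mem_orthogonalGroup_iff' (Fin n) ℂ).2 hg, hdet⟩, smul_eq_of_mem _ fun z hz =>
    F.mem_of_forall_vec (W := (L.graph A).V.comap (actMap g)) (fun c => ?_) hz⟩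
  rw [Submodule.mem_comap]
  rcases c with (i | i) | j | j
  · exact i.elim0
  · exact i.elim0
  · exact hmem j
  · change actMap g (Complex.I • F.e j) ∈ _
    rw [actMap_smul]
    exact F'.I_smul_mem (hmem j)

end Frame

/-! ### The orbit sets -/

lemma exists_frame_of_mem_orbitSet {ε : ℤˣ} {r s : ℕ} {L : IGr n ε} (hL : L ∈ orbitSet n ε r s) :
    Nonempty (Frame (L : MaxIso n) r s ((n - (r + s)) / 2)) := by
  obtain ⟨k, ⟨F⟩⟩ := exists_frame_of_hasSignature hL
  have hk : k = (n - (r + s)) / 2 := by have := F.card; omega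
  exact hk ▸ ⟨F⟩

lemma mem_orbit_of_mem_orbitSet {ε : ℤˣ} {r s : ℕ} (h : 0 < r + s) {K L : IGr n ε}
    (hL : L ∈ orbitSet n ε r s) (hK : K ∈ orbitSet n ε r s) :
    (K : MaxIso n) ∈ MulAction.orbit (SO n) (L : MaxIso n) := by
  obtain ⟨F⟩ := exists_frame_of_mem_orbitSet hL
  obtain ⟨F'⟩ := exists_frame_of_mem_orbitSet hK
  exact F.mem_orbit F' h

lemma mem_orbit_of_mem_chartAt_source {ε : ℤˣ} {K L : IGr n ε} (hL : L ∈ orbitSet n ε 0 0)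
    (hK : K ∈ orbitSet n ε 0 0) (h : K ∈ (chartAt (Skew n) L).source) :
    (K : MaxIso n) ∈ MulAction.orbit (SO n) (L : MaxIso n) := by
  obtain ⟨F⟩ := exists_frame_of_mem_orbitSet hL
  obtain ⟨F'⟩ := exists_frame_of_mem_orbitSet hK
  have h1 := graph_chartAt h
  rw [← h1] at F' ⊢
  exact F.graph_mem_orbit F'

/-- If `(r, s) = (0, 0)`, the orbit set may consist of two orbits, but no graph chart around a point of
one of them meets the other. -/
lemma isOpen_orbit {ε : ℤˣ} {r s : ℕ} {L : IGr n ε} (hL : L ∈ orbitSet n ε r s) :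
    IsOpen {K : orbitSet n ε r s |
      (K.1 : MaxIso n) ∈ MulAction.orbit (SO n) (L : MaxIso n)} := by
  rcases Nat.eq_zero_or_pos (r + s) with h | h
  · obtain ⟨rfl, rfl⟩ : r = 0 ∧ s = 0 := by omega
    -- The chart around a point of the orbit meets the orbit set only in the orbit.
    refine isOpen_iff_mem_nhds.2 fun K hK => ?_
    have hU : IsOpen {K' : orbitSet n ε 0 0 | K'.1 ∈ (chartAt (Skew n) K.1).source} :=
      (chartAt (Skew n) K.1).open_source.preimage continuous_subtype_val
    refine Filter.mem_of_superset (hU.mem_nhds (mem_chart_source (Skew n) K.1 :)) fun K' hK' => ?_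
    have h1 := mem_orbit_of_mem_chartAt_source K.2 K'.2 hK'
    rwa [MulAction.orbit_eq_iff.2 hK] at h1
  · convert isOpen_univ
    exact Set.eq_univ_of_forall fun K => mem_orbit_of_mem_orbitSet h hL K.2

end

end IsoGrass

open IsoGrass
theorem theorem4p3 (n : ℕ) (ε : ℤˣ) (r s : ℕ) :
    -- the relation of `𝒪₍ᵣ,ₛ₎` to the orbits of `SO(n, ℂ)`
    (∀ L ∈ orbitSet n ε r s,
      (∀ g : SO n, ∃ K ∈ orbitSet n ε r s, (K : MaxIso n) = g • (L : MaxIso n)) ∧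
      IsOpen {K : orbitSet n ε r s | (K.1 : MaxIso n) ∈ MulAction.orbit (SO n) (L : MaxIso n)} ∧
      (0 < r + s → ∀ K ∈ orbitSet n ε r s,
        (K : MaxIso n) ∈ MulAction.orbit (SO n) (L : MaxIso n))) ∧
    -- `𝒪₍ᵣ,ₛ₎` is an embedded submanifold
    ∃ (m : ℕ) (_ : ChartedSpace (EuclideanSpace ℝ (Fin m)) (orbitSet n ε r s)),
      IsManifold 𝓘(ℝ, EuclideanSpace ℝ (Fin m)) ∞ (orbitSet n ε r s) ∧
      Manifold.IsSmoothEmbedding 𝓘(ℝ, EuclideanSpace ℝ (Fin m)) 𝓘(ℝ, Skew n) ∞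
        (Subtype.val : orbitSet n ε r s → IGr n ε) ∧
      -- the slice theorem, with `U = φ.source`
      ∀ x ∈ orbitSet n ε r s, ∃ k : ℕ, n = r + s + 2 * k ∧
        ∃ φ : OpenPartialHomeomorph (IGr n ε) (orbitSet n ε r s × HermMat k),
          x ∈ φ.source ∧
          -- `φ` is a diffeomorphism from `U` onto `φ.target`
          ContMDiffOn 𝓘(ℝ, Skew n) (𝓘(ℝ, EuclideanSpace ℝ (Fin m)).prod 𝓘(ℝ, HermMat k)) ∞
            φ φ.source ∧
          ContMDiffOn (𝓘(ℝ, EuclideanSpace ℝ (Fin m)).prod 𝓘(ℝ, HermMat k)) 𝓘(ℝ, Skew n) ∞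
            φ.symm φ.target ∧
          -- `φ.target` is an open neighbourhood of `(U ∩ 𝒪) × {0}` in `(U ∩ 𝒪) × ℋₖ`
          (∀ p ∈ φ.target, (p.1 : IGr n ε) ∈ φ.source) ∧
          (∀ y : orbitSet n ε r s, (y : IGr n ε) ∈ φ.source → (y, 0) ∈ φ.target) ∧
          -- the orbit of a point of `U` is determined by the signature of its `ℋₖ`-component
          (∀ y ∈ φ.source, ∃ r' s', r ≤ r' ∧ s ≤ s' ∧ y ∈ orbitSet n ε r' s') ∧
          (∀ y ∈ φ.source, ∀ r' s', y ∈ orbitSet n ε r' s' ↔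
            r ≤ r' ∧ s ≤ s' ∧ HermMat.HasSignature (φ y).2 (r' - r) (s' - s)) := by
  refine ⟨fun L hL => ⟨fun g => ⟨⟨g • (L : MaxIso n), hodgeEigen_smul g L.2⟩,
    hasSignature_smul g hL, rfl⟩, isOpen_orbit hL, fun h K hK =>
      mem_orbit_of_mem_orbitSet h hL hK⟩, ?_⟩
  -- All points of the orbit set have radicals of the same complex dimension `k`, so that all slice
  -- charts have the same transverse dimension `m = dim Skew n - dim ℋₖ`. The subtraction of natural
  -- numbers can truncate only if the orbit set is empty, where the value of `m` is irrelevant.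
  obtain ⟨k, hk⟩ : ∃ k, k = (n - (r + s)) / 2 := ⟨_, rfl⟩
  have hF : ∀ x : orbitSet n ε r s, Nonempty (Frame (x.1 : MaxIso n) r s k) := fun x =>
    hk ▸ exists_frame_of_mem_orbitSet x.2
  choose C hC hsig using fun x => exists_sliceChart (hF x).some rfl
  refine ⟨_, SliceChart.chartedSpace C hC, SliceChart.isManifold C hC,
    SliceChart.isSmoothEmbedding C hC, fun x hx => ⟨k, (hF ⟨x, hx⟩).some.card,
      (C ⟨x, hx⟩).sliceHomeo ⟨x, hx⟩, hC ⟨x, hx⟩, SliceChart.contMDiffOn_sliceHomeo C hC ⟨x, hx⟩,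
      SliceChart.contMDiffOn_sliceHomeo_symm C hC ⟨x, hx⟩, fun p hp => hp, fun y hy => hy,
      fun y hy => ?_, fun y hy r' s' => ?_⟩⟩
  · exact ⟨_, _, Nat.le_add_right r _, Nat.le_add_right s _,
      hsig ⟨x, hx⟩ y hy _ _ (exists_hasSignature _)⟩
  · constructor
    · intro h
      have h1 := hsig ⟨x, hx⟩ y hy _ _ (exists_hasSignature _)
      have hr := h1.1.symm.trans h.1
      have hs := h1.2.symm.trans h.2
      subst hr hs
      rw [Nat.add_sub_cancel_left, Nat.add_sub_cancel_left]
      exact ⟨Nat.le_add_right r _, Nat.le_add_right s _, exists_hasSignature _⟩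
    · rintro ⟨hr, hs, h⟩
      have h1 := hsig ⟨x, hx⟩ y hy _ _ h
      rwa [Nat.add_sub_cancel' hr, Nat.add_sub_cancel' hs] at h1
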